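/- **Setting.** Let $n\ge 1$ agents minimise, over rounds $t=1,\dots,T$, the global losses $F_t=\sum_{i=1}^n f_{i,t}$ on a convex compact set $X\subset\mathbb R^d$ (Euclidean norm). Agent $i$ receives, at round $t$, from its in-neighbours $\mathcal N_i(t)=\{j:(j,i)\in\mathcal E_t\}\cup\{i\}$ in a directed graph $\mathcal G_t$ on $\{1,\dots,n\}$ with weight matrix $A_t\in\mathbb R^{n\times n}$. For all $t\le T$ and all $i$ assume: $[A_t]_{ij}>0$ if $j\in\mathcal N_i(t)$ and $[A_t]_{ij}=0$ otherwise; every positive entry of $A_t$ is larger than $\zeta>0$; $\mathcal G_t$ is strongly connected; $A_t$ is doubly stochastic; $\|x-z\|\le M$ for $x,z\in X$; $f_{i,t}$ is convex on $X$, differentiable at every point of $X$, and satisfies $|f_{i,t}(x)-f_{i,t}(z)|\le L_X\|x-z\|$ and $f_{i,t}(x)-f_{i,t}(z)\le\langle\nabla f_{i,t}(z),x-z\rangle+\frac{G_X}{2}\|x-z\|^2$ for $x,z\in X$, where $L_X,G_X>0$. **Algorithm.** Start with $x_{i,1}\in X$. In round $t$ put $x_{i,t}^1=x_{i,t}$;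 for $k=1,\dots,K_t$ every agent $i$ computes $$\hat x_{i,t}^k=\sum_{j\in\mathcal N_i(t)}[A_t]_{ij}x_{j,t}^k,\qquad \widehat\nabla f_{i,t}^k=\sum_{j\in\mathcal N_i(t)}[A_t]_{ij}\overline\nabla f_{j,t}^k,$$ where $\overline\nabla f_{i,t}^1=\nabla f_{i,t}(\hat x_{i,t}^1)$ and $\overline\nabla f_{i,t}^k=\widehat\nabla f_{i,t}^{k-1}+\nabla f_{i,t}(\hat x_{i,t}^k)-\nabla f_{i,t}(\hat x_{i,t}^{k-1})$ for $k\ge2$; it then calls a linear oracle for some $v_{i,t}^k\in\arg\min_{x\in X}\langle x,\widehat\nabla f_{i,t}^k\rangle$ and sets $x_{i,t}^{k+1}=\hat x_{i,t}^k+\alpha_t(v_{i,t}^k-\hat x_{i,t}^k)$. Finally $x_{i,t+1}=x_{i,t}^{K_t+1}$. Let $\mathbf N_{LO}$ be the number of oracle calls made by an agent in rounds $1,\dots,T$. Put $$\mathbf{Regret}_d^j(T)=\sum_{t=1}^TF_t(x_{j,t})-\sum_{t=1}^TF_t(x_t^*),\quad x_t^*\in\arg\min_{x\in X}F_t(x),\qquad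 H_T=\sum_{t=1}^{T-1}\max_i\max_{x\in X}|f_{i,t+1}(x)-f_{i,t}(x)|.$$ **Claim.** Let $\rho\ge1$, $\varepsilon_1>0$ and $\bar\gamma<1$. There is a constant $C>0$, depending only on $n,\zeta,M,L_X,G_X,\rho,\varepsilon_1,\bar\gamma$, such that the following holds for all $d$, all $T\ge2$, all problems as above, all $\gamma_1$ with $0<\gamma_1\le\bar\gamma$, and all runs of the algorithm with $K_t=\lceil\varepsilon_1t^{\gamma_1}\rceil+1$ and $\alpha_t=1/(\rho K_t)$ (for a fixed exponent $\gamma_1\in(0,1)$ take $\bar\gamma=\gamma_1$; then $K_t$ needs no knowledge of $T$ or $H_T$). For every agent $j$, $$\mathbf{Regret}_d^j(T)\le C\,(T^{1-\gamma_1}+H_T),\qquad \mathbf N_{LO}\le C\,T^{1+\gamma_1}.$$ If moreover $1-\log_TH_T\le\gamma_1$, then $\mathbf{Regret}_d^j(T)\le C\,H_T$. If $\gamma_1$ is the smallest such exponent, $\gamma_1=1-\log_TH_T$, then $\mathbf{Regret}_d^j(T)\le C\,H_T$ and $\mathbf N_{LO}\le C\,T^{2-\log_TH_T}$. -/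

import Mathlib

noncomputable section

namespace DOMFW

/-- The points of `X` that minimise `φ` over `X`. -/
def argminOn {E : Type*} (X : Set E) (φ : E → ℝ) : Set E :=
  {x | x ∈ X ∧ ∀ y ∈ X, φ x ≤ φ y}

/-- Data of a distributed online optimization problem with `n` agents in `ℝ^d`:
constraint set, losses `f i t` of agent `i` at round `t`, communication digraphs
(`(graph t).Adj j i` means that `i` receives from `j` at round `t`), weight matrices.
Rounds are numbered from `1`. -/
structure Problem (n d : ℕ) where
  X : Set (EuclideanSpace ℝ (Fin d))
  f : Fin n → ℕ → EuclideanSpace ℝ (Fin d) → ℝ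
  graph : ℕ → Digraph (Fin n)
  A : ℕ → Matrix (Fin n) (Fin n) ℝ

namespace Problem

variable {n d : ℕ} (p : Problem n d)

open scoped Classical in
/-- In-neighbours of agent `i` at round `t`, including `i` itself. -/
def inNbrs (t : ℕ) (i : Fin n) : Finset (Fin n) :=
  Finset.univ.filter fun j => (p.graph t).Adj j i ∨ j = i

/-- Global loss at round `t`. -/
def F (t : ℕ) (x : EuclideanSpace ℝ (Fin d)) : ℝ := ∑ i, p.f i t x

/-- Function variation over the rounds `1, …, T`. -/
def H (T : ℕ) : ℝ :=
  ∑ t ∈ Finset.Icc 1 (T - 1), ⨆ i : Fin n, ⨆ x : p.X, |p.f i (t + 1) x - p.f i t x|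

/-- The standing assumptions, over the rounds `1, …, T`. -/
structure Assumptions (ζ M L G : ℝ) (T : ℕ) : Prop where
  convex_X : Convex ℝ p.X
  compact_X : IsCompact p.X
  convex_f : ∀ i, ∀ t ∈ Finset.Icc 1 T, ConvexOn ℝ p.X (p.f i t)
  weight_pos : ∀ t ∈ Finset.Icc 1 T, ∀ i, ∀ j ∈ p.inNbrs t i, 0 < p.A t i j
  weight_zero : ∀ t ∈ Finset.Icc 1 T, ∀ i, ∀ j ∉ p.inNbrs t i, p.A t i j = 0
  weight_gt : ∀ t ∈ Finset.Icc 1 T, ∀ i j, 0 < p.A t i j → ζ < p.A t i j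
  strongly_connected : ∀ t ∈ Finset.Icc 1 T, ∀ i j, Relation.ReflTransGen (p.graph t).Adj i j
  doubly_stochastic : ∀ t ∈ Finset.Icc 1 T, p.A t ∈ doublyStochastic ℝ (Fin n)
  diam_le : ∀ x ∈ p.X, ∀ z ∈ p.X, ‖x - z‖ ≤ M
  lipschitz : ∀ i, ∀ t ∈ Finset.Icc 1 T, ∀ x ∈ p.X, ∀ z ∈ p.X,
    |p.f i t x - p.f i t z| ≤ L * ‖x - z‖
  differentiable : ∀ i, ∀ t ∈ Finset.Icc 1 T, ∀ x ∈ p.X, DifferentiableAt ℝ (p.f i t) x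
  smooth : ∀ i, ∀ t ∈ Finset.Icc 1 T, ∀ x ∈ p.X, ∀ z ∈ p.X,
    p.f i t x - p.f i t z ≤ inner ℝ (gradient (p.f i t) z) (x - z) + G / 2 * ‖x - z‖ ^ 2

end Problem

/-- State of the network during the execution of the algorithm: current points `x i`, the mixed
points `xhat i` and gradient estimates `ghat i` of the latest inner iteration, and the number
`calls i` of linear-oracle calls that agent `i` has made so far. -/
structure State (n d : ℕ) where
  x : Fin n → EuclideanSpace ℝ (Fin d)
  xhat : Fin n → EuclideanSpace ℝ (Fin d)
  ghat : Fin n → EuclideanSpace ℝ (Fin d)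
  calls : Fin n → ℕ

/-- Inputs of the algorithm: initial points, step sizes, numbers of inner iterations, and the
linear oracle: `oracle i t k b` is the answer to the query `b` which agent `i` makes in the inner
iteration `k` of round `t` (ties may be broken differently at each call). -/
structure Input (n d : ℕ) where
  x₁ : Fin n → EuclideanSpace ℝ (Fin d)
  α : ℕ → ℝ
  K : ℕ → ℕ
  oracle : Fin n → ℕ → ℕ → EuclideanSpace ℝ (Fin d) → EuclideanSpace ℝ (Fin d)

/-- The initial points are feasible and every oracle answer solves the linear problem. -/
structure Input.Valid {n d : ℕ} (a : Input n d) (X : Set (EuclideanSpace ℝ (Fin d))) : Prop where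
  init_mem : ∀ i, a.x₁ i ∈ X
  oracle_mem : ∀ i t k b, a.oracle i t k b ∈ argminOn X fun x => inner ℝ x b

variable {n d : ℕ} (p : Problem n d) (a : Input n d)

/-- Inner iteration `k ≥ 1` of round `t`: consensus, gradient tracking, Frank-Wolfe step. -/
def innerStep (t k : ℕ) (s : State n d) : State n d :=
  let xhat : Fin n → EuclideanSpace ℝ (Fin d) :=
    fun i => ∑ j ∈ p.inNbrs t i, p.A t i j • s.x j
  let gbar : Fin n → EuclideanSpace ℝ (Fin d) := fun i =>
    if k = 1 then gradient (p.f i t) (xhat i)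
    else s.ghat i + gradient (p.f i t) (xhat i) - gradient (p.f i t) (s.xhat i)
  let ghat : Fin n → EuclideanSpace ℝ (Fin d) :=
    fun i => ∑ j ∈ p.inNbrs t i, p.A t i j • gbar j
  let v : Fin n → EuclideanSpace ℝ (Fin d) := fun i => a.oracle i t k (ghat i)
  { x := fun i => xhat i + a.α t • (v i - xhat i)
    xhat := xhat
    ghat := ghat
    calls := fun i => s.calls i + 1 }

/-- State after the inner iterations `1, …, k` of round `t`, started from `s`. -/
def innerLoop (t : ℕ) (s : State n d) : ℕ → State n d
  | 0 => s
  | k + 1 => innerStep p a t (k + 1) (innerLoop t s k)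

/-- State after the rounds `1, …, t`. -/
def run : ℕ → State n d
  | 0 => { x := a.x₁, xhat := 0, ghat := 0, calls := 0 }
  | t + 1 => innerLoop p a (t + 1) (run t) (a.K (t + 1))

/-- Decision of agent `i` at round `t ≥ 1`. -/
def decision (i : Fin n) (t : ℕ) : EuclideanSpace ℝ (Fin d) := (run p a (t - 1)).x i

/-- Number of linear-oracle calls of agent `i` in the rounds `1, …, T`. -/
def oracleCalls (i : Fin n) (T : ℕ) : ℕ := (run p a T).calls i

/-- Dynamic regret of agent `j` over the rounds `1, …, T` against the comparators `xstar t`. -/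
def regret (xstar : ℕ → EuclideanSpace ℝ (Fin d)) (j : Fin n) (T : ℕ) : ℝ :=
  ∑ t ∈ Finset.Icc 1 T, p.F t (decision p a j t) - ∑ t ∈ Finset.Icc 1 T, p.F t (xstar t)

/-- Numbers of inner iterations `⌈ε t ^ γ⌉ + 1`. -/
def innerCount (ε γ : ℝ) (t : ℕ) : ℕ := ⌈ε * (t : ℝ) ^ γ⌉₊ + 1

end DOMFW

end

/-! In every inner iteration the mean of the agents' points makes an inexact Frank-Wolfe step on the
global loss, and the proof follows the optimality gap of that mean. Doubly stochastic mixing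
preserves means and contracts the `ℓ²` deviation from the mean by a factor `contraction n ζ < 1`
(`disp_mix_le`). Gradient tracking keeps the mean of the estimates equal to the mean of the local
gradients at the mixed points, so the direction error in `TrackingRun.sum_avg_succ_le` is controlled
by the dispersions of points and estimates. These contract up to `O(α)` inputs, and
`coupled_recursion_le` absorbs them in a Lyapunov function: even when a round starts from `O(1)`
dispersions, it costs only `O(α_t)` besides the decay of the gap.

Since `α_t K_t = 1/ρ`, a round multiplies the gap by at most `exp (-1/ρ)` and adds `O(α_t)`;
replacing the loss by the next one adds at most `2n` times the variation. Summing this contraction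
gives `O(1 + ∑ α_t + H_T)`, and the summed dispersions carry the bound from the mean to a single
agent (`regret_le`). Finally `K_t ≥ ε t^γ` gives `∑ α_t = O(T^(1-γ))`.

Smoothness is assumed only as an inequality on `X`, which says nothing about gradient components
normal to the directions of `X`. All gradients are therefore projected onto `vectorSpan ℝ X`. The
projection commutes with mixing and changes no inner product with a difference of feasible points,
so oracle answers stay optimal; and projected gradients are `G`-Lipschitz up to the relative
boundary (`SmoothConvexOn.norm_sub_le`). -/

set_option linter.unusedSectionVars false

namespace DOMFW

/-! ### Consensus: contraction of the dispersion under doubly stochastic mixing. -/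

section Mixing

variable {ι E : Type*} [Fintype ι] [NormedAddCommGroup E] [InnerProductSpace ℝ E]

/-- The average of a finite family of vectors. -/
noncomputable def avg (x : ι → E) : E := (Fintype.card ι : ℝ)⁻¹ • ∑ i, x i

/-- The `ℓ²` norm of a finite family of vectors. -/
noncomputable def norm2 (x : ι → E) : ℝ := ‖WithLp.toLp 2 x‖

/-- The `ℓ²` distance of a finite family of vectors from its average. -/
noncomputable def disp (x : ι → E) : ℝ := norm2 fun i => x i - avg x

/-- One consensus step with weight matrix `A`. -/
def mix (A : Matrix ι ι ℝ) (x : ι → E) : ι → E := fun i => ∑ j, A i j • x j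

/-- The factor by which a consensus step contracts the dispersion. -/
noncomputable def contraction (n : ℕ) (ζ : ℝ) : ℝ := √(1 - ζ ^ 2 / (n : ℝ) ^ 3)

lemma norm2_sq (x : ι → E) : norm2 x ^ 2 = ∑ i, ‖x i‖ ^ 2 := by
  simp [norm2, PiLp.norm_sq_eq_of_L2]

lemma norm2_nonneg (x : ι → E) : 0 ≤ norm2 x := norm_nonneg _

lemma disp_nonneg (x : ι → E) : 0 ≤ disp x := norm2_nonneg _

lemma norm2_add_le (x y : ι → E) : norm2 (x + y) ≤ norm2 x + norm2 y := by
  unfold norm2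
  rw [WithLp.toLp_add]
  exact norm_add_le _ _

lemma norm2_sub_le (x y : ι → E) : norm2 (x - y) ≤ norm2 x + norm2 y := by
  unfold norm2
  rw [WithLp.toLp_sub]
  exact norm_sub_le _ _

lemma norm2_smul (c : ℝ) (x : ι → E) : norm2 (c • x) = |c| * norm2 x := by
  unfold norm2
  rw [WithLp.toLp_smul, norm_smul, Real.norm_eq_abs]

lemma norm2_le_of_norm_le {F : Type*} [NormedAddCommGroup F] [InnerProductSpace ℝ F]
    {x : ι → E} {y : ι → F} {c : ℝ} (hc : 0 ≤ c)
    (h : ∀ i, ‖x i‖ ≤ c * ‖y i‖) : norm2 x ≤ c * norm2 y := by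
  refine le_of_sq_le_sq ?_ (mul_nonneg hc (norm2_nonneg y))
  rw [mul_pow, norm2_sq, norm2_sq, Finset.mul_sum]
  refine Finset.sum_le_sum fun i _ => ?_
  rw [← mul_pow]
  exact pow_le_pow_left₀ (norm_nonneg _) (h i) 2

lemma norm_le_norm2 (x : ι → E) (i : ι) : ‖x i‖ ≤ norm2 x :=
  PiLp.norm_apply_le (WithLp.toLp 2 x) i

lemma norm2_le_card_mul {x : ι → E} {B : ℝ} (hB : 0 ≤ B) (h : ∀ i, ‖x i‖ ≤ B) :
    norm2 x ≤ Fintype.card ι * B := by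
  refine le_of_sq_le_sq ?_ (by positivity)
  rw [norm2_sq]
  calc ∑ i, ‖x i‖ ^ 2 ≤ ∑ _i : ι, B ^ 2 :=
        Finset.sum_le_sum fun i _ => pow_le_pow_left₀ (norm_nonneg _) (h i) 2
    _ = Fintype.card ι * B ^ 2 := by simp
    _ ≤ (Fintype.card ι * B) ^ 2 := by
        rw [mul_pow]
        refine mul_le_mul_of_nonneg_right ?_ (sq_nonneg _)
        exact_mod_cast Nat.le_self_pow two_ne_zero _

lemma avg_add (x y : ι → E) : avg (x + y) = avg x + avg y := by
  simp [avg, Finset.sum_add_distrib]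

lemma avg_sub (x y : ι → E) : avg (x - y) = avg x - avg y := by
  simp [avg, Finset.sum_sub_distrib, smul_sub]

lemma avg_smul (c : ℝ) (x : ι → E) : avg (c • x) = c • avg x := by
  simp [avg, ← Finset.smul_sum, smul_comm c]

lemma card_smul_avg [Nonempty ι] (x : ι → E) : (Fintype.card ι : ℝ) • avg x = ∑ i, x i := by
  rw [avg, smul_inv_smul₀]
  exact_mod_cast Fintype.card_ne_zero

lemma avg_const [Nonempty ι] (y : E) : avg (fun _ : ι => y) = y := by
  simp [avg, ← Nat.cast_smul_eq_nsmul ℝ]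

lemma avg_mem [Nonempty ι] {X : Set E} (hX : Convex ℝ X) {x : ι → E} (hx : ∀ i, x i ∈ X) :
    avg x ∈ X := by
  rw [avg, Finset.smul_sum]
  refine hX.sum_mem (fun _ _ => by positivity) ?_ fun i _ => hx i
  simp

lemma norm_avg_le [Nonempty ι] {x : ι → E} {B : ℝ} (h : ∀ i, ‖x i‖ ≤ B) : ‖avg x‖ ≤ B := by
  have := avg_mem (convex_closedBall (0 : E) B) (x := x) (by simpa using h)
  simpa using this

lemma disp_add_le (x y : ι → E) : disp (x + y) ≤ disp x + disp y := by
  refine le_trans (le_of_eq ?_) (norm2_add_le _ _)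
  unfold disp
  congr 1
  funext i
  simp only [avg_add, Pi.add_apply]
  abel

lemma disp_smul (c : ℝ) (x : ι → E) : disp (c • x) = |c| * disp x := by
  rw [disp, disp, ← norm2_smul]
  congr 1
  funext i
  simp [avg_smul, smul_sub]

lemma norm_sub_avg_le_disp (x : ι → E) (i : ι) : ‖x i - avg x‖ ≤ disp x :=
  norm_le_norm2 (fun i => x i - avg x) i

/-- Subtracting the mean is an orthogonal projection. -/
lemma disp_le_norm2 [Nonempty ι] (x : ι → E) : disp x ≤ norm2 x := by
  refine le_of_sq_le_sq ?_ (norm2_nonneg _)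
  rw [disp, norm2_sq, norm2_sq]
  have h : ∑ i, ‖x i - avg x‖ ^ 2
      = ∑ i, ‖x i‖ ^ 2 - (Fintype.card ι : ℝ) * ‖avg x‖ ^ 2 := by
    simp only [norm_sub_sq_real, Finset.sum_add_distrib, Finset.sum_sub_distrib,
      ← Finset.mul_sum, ← sum_inner, ← card_smul_avg x, inner_smul_left,
      real_inner_self_eq_norm_sq]
    simp
    ring
  rw [h]
  have : 0 ≤ (Fintype.card ι : ℝ) * ‖avg x‖ ^ 2 := by positivity
  linarith

lemma disp_le_of_diam [Nonempty ι] {X : Set E} (hX : Convex ℝ X) {M : ℝ} (hM : 0 ≤ M)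
    (hdiam : ∀ x ∈ X, ∀ z ∈ X, ‖x - z‖ ≤ M) {x : ι → E} (hx : ∀ i, x i ∈ X) :
    disp x ≤ Fintype.card ι * M :=
  norm2_le_card_mul hM fun i => hdiam _ (hx i) _ (avg_mem hX hx)

/-- Jensen's equality for the squared norm. -/
lemma norm_sum_smul_sq_add {w : ι → ℝ} (hw : ∑ j, w j = 1) (x : ι → E) :
    ‖∑ j, w j • x j‖ ^ 2 + 2⁻¹ * ∑ j, ∑ k, w j * w k * ‖x j - x k‖ ^ 2
      = ∑ j, w j * ‖x j‖ ^ 2 := by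
  have h1 : ‖∑ j, w j • x j‖ ^ 2 = ∑ j, ∑ k, w j * w k * inner ℝ (x j) (x k) := by
    rw [← real_inner_self_eq_norm_sq, sum_inner]
    refine Finset.sum_congr rfl fun j _ => ?_
    rw [inner_sum]
    refine Finset.sum_congr rfl fun k _ => ?_
    rw [inner_smul_left, inner_smul_right]
    simp
    ring
  have h2 : ∑ j, ∑ k, w j * w k * ‖x j‖ ^ 2 = ∑ j, w j * ‖x j‖ ^ 2 := by
    refine Finset.sum_congr rfl fun j _ => ?_
    rw [← Finset.sum_mul, ← Finset.mul_sum, hw, mul_one]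
  have h3 : ∑ j, ∑ k, w j * w k * ‖x k‖ ^ 2 = ∑ j, w j * ‖x j‖ ^ 2 := by
    rw [Finset.sum_comm, ← h2]
    refine Finset.sum_congr rfl fun j _ => Finset.sum_congr rfl fun k _ => by ring
  have h4 : ∑ j, ∑ k, w j * w k * ‖x j - x k‖ ^ 2
      = 2 * ∑ j, w j * ‖x j‖ ^ 2 - 2 * ‖∑ j, w j • x j‖ ^ 2 := by
    calc _ = ∑ j, ∑ k, (w j * w k * ‖x j‖ ^ 2 + w j * w k * ‖x k‖ ^ 2
            - 2 * (w j * w k * inner ℝ (x j) (x k))) := by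
          refine Finset.sum_congr rfl fun j _ => Finset.sum_congr rfl fun k _ => ?_
          rw [norm_sub_sq_real]
          ring
      _ = _ := by
          have h5 : ∑ j, ∑ k, 2 * (w j * w k * inner ℝ (x j) (x k))
              = 2 * ‖∑ j, w j • x j‖ ^ 2 := by
            rw [h1]
            simp only [Finset.mul_sum]
          simp only [Finset.sum_sub_distrib, Finset.sum_add_distrib, h2, h3, h5]
          ring
  rw [h4]
  ring

/-- A family that varies by at most `δ` along the edges of a connected relation varies by at
most `card ι * δ`. -/
lemma norm_sub_le_card_mul {r : ι → ι → Prop} (hr : ∀ i j, Relation.ReflTransGen r i j)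
    {x : ι → E} {δ : ℝ} (hδ : 0 ≤ δ) (h : ∀ i j, r i j → ‖x i - x j‖ ≤ δ) (i j : ι) :
    ‖x i - x j‖ ≤ Fintype.card ι * δ := by
  classical
  let B : ℕ → Finset ι := fun m => Finset.univ.filter fun j => ‖x i - x j‖ ≤ m * δ
  -- The balls `B m` are taken in the values of `x`, not in the graph. If `B m = B (m + 1)`, then `B
  -- m` is closed under edges and hence everything; otherwise it gains an element.
  have key : ∀ m, m + 1 ≤ (B m).card ∨ B m = Finset.univ := by
    intro m
    induction m with
    | zero =>
      left
      refine Finset.card_pos.2 ⟨i, ?_⟩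
      simp [B]
    | succ m ih =>
      have hsub : B m ⊆ B (m + 1) := by
        intro k hk
        simp only [B, Finset.mem_filter, Finset.mem_univ, true_and] at hk ⊢
        push_cast
        linarith
      rcases ih with ih | ih
      · by_cases hall : B (m + 1) = Finset.univ
        · exact Or.inr hall
        · left
          obtain ⟨k, hk⟩ : ∃ k, k ∉ B (m + 1) := by
            by_contra! hcon
            exact hall (Finset.eq_univ_of_forall hcon)
          have hne : B m ≠ B (m + 1) := by
            intro heq
            have hmem : ∀ l, Relation.ReflTransGen r i l → l ∈ B m := by
              intro l hl
              induction hl with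
              | refl =>
                simp only [B, Finset.mem_filter, Finset.mem_univ, true_and, sub_self, norm_zero]
                positivity
              | tail _ hbc ihl =>
                rw [heq]
                simp only [B, Finset.mem_filter, Finset.mem_univ, true_and] at ihl ⊢
                have := norm_sub_le_norm_sub_add_norm_sub (x i) (x _) (x _) |>.trans
                  (add_le_add ihl (h _ _ hbc))
                push_cast
                linarith
            exact hk (hsub (hmem k (hr i k)))
          have := Finset.card_lt_card (hsub.ssubset_of_ne hne)
          omega
      · exact Or.inr (Finset.univ_subset_iff.1 (ih ▸ hsub))
  have hB : B (Fintype.card ι) = Finset.univ := by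
    rcases key (Fintype.card ι) with hk | hk
    · have := Finset.card_le_univ (B (Fintype.card ι))
      omega
    · exact hk
  have hj : j ∈ B (Fintype.card ι) := hB ▸ Finset.mem_univ j
  simpa [B] using hj

section DoublyStochastic

variable [DecidableEq ι] {A : Matrix ι ι ℝ}

lemma avg_mix (hA : A ∈ doublyStochastic ℝ ι) (x : ι → E) : avg (mix A x) = avg x := by
  unfold avg mix
  congr 1
  rw [Finset.sum_comm]
  refine Finset.sum_congr rfl fun j _ => ?_
  rw [← Finset.sum_smul, (mem_doublyStochastic_iff_sum.1 hA).2.2 j, one_smul]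

lemma mix_mem (hA : A ∈ doublyStochastic ℝ ι) {X : Set E} (hX : Convex ℝ X) {x : ι → E}
    (hx : ∀ i, x i ∈ X) (i : ι) : mix A x i ∈ X :=
  hX.sum_mem (fun j _ => (mem_doublyStochastic_iff_sum.1 hA).1 i j)
    ((mem_doublyStochastic_iff_sum.1 hA).2.1 i) fun j _ => hx j

lemma mix_sub_const (hA : A ∈ doublyStochastic ℝ ι) (x : ι → E) (y : E) (i : ι) :
    mix A (fun j => x j - y) i = mix A x i - y := by
  simp [mix, smul_sub, Finset.sum_sub_distrib, ← Finset.sum_smul,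
    (mem_doublyStochastic_iff_sum.1 hA).2.1 i]

/-- Jensen's equality in each row, summed using that the columns sum to one. The loss of norm is
thus an explicit sum of squared differences. -/
lemma norm2_mix_sq (hA : A ∈ doublyStochastic ℝ ι) (x : ι → E) :
    norm2 (mix A x) ^ 2 + 2⁻¹ * ∑ i, ∑ j, ∑ k, A i j * A i k * ‖x j - x k‖ ^ 2
      = norm2 x ^ 2 := by
  rw [norm2_sq, norm2_sq, Finset.mul_sum, ← Finset.sum_add_distrib]
  simp only [mix]
  rw [Finset.sum_congr rfl fun i _ =>
    norm_sum_smul_sq_add ((mem_doublyStochastic_iff_sum.1 hA).2.1 i) x, Finset.sum_comm]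
  refine Finset.sum_congr rfl fun j _ => ?_
  rw [← Finset.sum_mul, (mem_doublyStochastic_iff_sum.1 hA).2.2 j, one_mul]

lemma norm2_mix_le (hA : A ∈ doublyStochastic ℝ ι) (x : ι → E) : norm2 (mix A x) ≤ norm2 x := by
  refine le_of_sq_le_sq ?_ (norm2_nonneg _)
  rw [← norm2_mix_sq hA x]
  have h0 := (mem_doublyStochastic_iff_sum.1 hA).1
  have : 0 ≤ ∑ i, ∑ j, ∑ k, A i j * A i k * ‖x j - x k‖ ^ 2 :=
    Finset.sum_nonneg fun i _ => Finset.sum_nonneg fun j _ => Finset.sum_nonneg fun k _ =>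
      mul_nonneg (mul_nonneg (h0 i j) (h0 i k)) (sq_nonneg _)
  linarith

lemma norm2_mix_sub_le (hA : A ∈ doublyStochastic ℝ ι) (x : ι → E) :
    norm2 (mix A x - x) ≤ 2 * disp x := by
  have h : mix A x - x = mix A (fun j => x j - avg x) - fun j => x j - avg x := by
    funext i
    simp [mix_sub_const hA]
  rw [h]
  refine (norm2_sub_le _ _).trans ?_
  have := norm2_mix_le hA fun j => x j - avg x
  unfold disp
  linarith

/-- The loss `S` in `norm2_mix_sq` bounds the difference across every edge by `√S / ζ`; connectivity
then bounds all differences by `n √S / ζ`. Hence `disp x ^ 2 ≤ n ^ 3 S / ζ ^ 2`, so a fixed fraction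
of the squared dispersion is lost. -/
lemma disp_mix_le [Nonempty ι] (hA : A ∈ doublyStochastic ℝ ι) {ζ : ℝ} (hζ : 0 < ζ)
    {r : ι → ι → Prop} (hr : ∀ i j, Relation.ReflTransGen r i j)
    (hdiag : ∀ i, ζ < A i i) (hedge : ∀ i j, r i j → ζ < A j i) (x : ι → E) :
    disp (mix A x) ≤ contraction (Fintype.card ι) ζ * disp x := by
  have h0 := (mem_doublyStochastic_iff_sum.1 hA).1
  set y : ι → E := fun j => x j - avg x with hy
  have hmix : disp (mix A x) = norm2 (mix A y) := by
    unfold disp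
    congr 1
    funext i
    rw [avg_mix hA, mix_sub_const hA]
  set S : ℝ := 2⁻¹ * ∑ i, ∑ j, ∑ k, A i j * A i k * ‖y j - y k‖ ^ 2 with hS
  have hid : norm2 (mix A y) ^ 2 + S = disp x ^ 2 := norm2_mix_sq hA y
  have hterm : ∀ i j k, 0 ≤ A i j * A i k * ‖y j - y k‖ ^ 2 := fun i j k =>
    mul_nonneg (mul_nonneg (h0 i j) (h0 i k)) (sq_nonneg _)
  have hS0 : 0 ≤ S := mul_nonneg (by norm_num) <| Finset.sum_nonneg fun i _ =>
    Finset.sum_nonneg fun j _ => Finset.sum_nonneg fun k _ => hterm i j k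
  have hrow : ∀ j, ∑ i, ∑ k, A j i * A j k * ‖y i - y k‖ ^ 2 ≤ 2 * S := by
    intro j
    have := Finset.single_le_sum (f := fun i => ∑ j, ∑ k, A i j * A i k * ‖y j - y k‖ ^ 2)
      (fun i _ => Finset.sum_nonneg fun j _ => Finset.sum_nonneg fun k _ => hterm i j k)
      (Finset.mem_univ j)
    rw [hS]
    linarith
  have hE : ∀ i j, r i j → ‖y i - y j‖ ≤ √S / ζ := by
    intro i j hij
    rw [le_div_iff₀ hζ]
    refine Real.le_sqrt_of_sq_le ?_
    by_cases hne : i = j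
    · simpa [hne] using hS0
    -- Row `j` sees both ends of the edge because its diagonal weight is positive; counting both
    -- ordered pairs cancels the factor `2⁻¹` in `S`.
    have h2 : A j i * A j j * ‖y i - y j‖ ^ 2 + A j j * A j i * ‖y j - y i‖ ^ 2 ≤ 2 * S := by
      refine le_trans ?_ (hrow j)
      have hpair := Finset.add_le_sum (s := Finset.univ)
        (f := fun l => ∑ k, A j l * A j k * ‖y l - y k‖ ^ 2)
        (fun l _ => Finset.sum_nonneg fun k _ => hterm j l k) (Finset.mem_univ i)
        (Finset.mem_univ j) hne
      refine le_trans (add_le_add ?_ ?_) hpair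
      · exact Finset.single_le_sum (f := fun k => A j i * A j k * ‖y i - y k‖ ^ 2)
          (fun k _ => hterm j i k) (Finset.mem_univ j)
      · exact Finset.single_le_sum (f := fun k => A j j * A j k * ‖y j - y k‖ ^ 2)
          (fun k _ => hterm j j k) (Finset.mem_univ i)
    rw [norm_sub_rev (y j) (y i)] at h2
    have h3 : ζ * ζ ≤ A j i * A j j :=
      mul_le_mul (hedge i j hij).le (hdiag j).le hζ.le (h0 j i)
    have h4 := mul_le_mul_of_nonneg_right h3 (sq_nonneg ‖y i - y j‖)
    nlinarith
  have hn : (0 : ℝ) < Fintype.card ι := by exact_mod_cast Fintype.card_pos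
  have hdiam := norm_sub_le_card_mul hr (by positivity) hE
  have hy_le : ∀ i, ‖y i‖ ≤ Fintype.card ι * (√S / ζ) := by
    intro i
    have h1 : y i = avg fun j => y i - y j := by
      have : (fun j => y i - y j) = (fun _ : ι => x i) - x := by
        funext j
        simp [hy]
      rw [this, avg_sub, avg_const]
    rw [h1]
    exact norm_avg_le fun j => hdiam i j
  have hD : disp x ^ 2 ≤ (Fintype.card ι : ℝ) ^ 3 * S / ζ ^ 2 := by
    have : disp x ^ 2 = ∑ i, ‖y i‖ ^ 2 := norm2_sq y
    rw [this]
    calc ∑ i, ‖y i‖ ^ 2 ≤ ∑ _i : ι, (Fintype.card ι * (√S / ζ)) ^ 2 :=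
          Finset.sum_le_sum fun i _ => pow_le_pow_left₀ (norm_nonneg _) (hy_le i) 2
      _ = (Fintype.card ι : ℝ) ^ 3 * S / ζ ^ 2 := by
          rw [mul_pow, div_pow, Real.sq_sqrt hS0]
          simp
          ring
  have hfin : norm2 (mix A y) ^ 2 ≤ (1 - ζ ^ 2 / (Fintype.card ι : ℝ) ^ 3) * disp x ^ 2 := by
    have : ζ ^ 2 / (Fintype.card ι : ℝ) ^ 3 * disp x ^ 2 ≤ S := by
      calc _ ≤ ζ ^ 2 / (Fintype.card ι : ℝ) ^ 3 * ((Fintype.card ι : ℝ) ^ 3 * S / ζ ^ 2) := by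
            gcongr
        _ = S := by field_simp
    linarith
  rw [hmix, contraction, ← Real.sqrt_sq (disp_nonneg x), ← Real.sqrt_mul' _ (sq_nonneg _)]
  exact Real.le_sqrt_of_sq_le hfin

lemma contraction_nonneg (n : ℕ) (ζ : ℝ) : 0 ≤ contraction n ζ := Real.sqrt_nonneg _

lemma contraction_lt_one {n : ℕ} (hn : 0 < n) {ζ : ℝ} (hζ : 0 < ζ) : contraction n ζ < 1 := by
  rw [contraction, Real.sqrt_lt' one_pos]
  have : 0 < ζ ^ 2 / (n : ℝ) ^ 3 := by positivity
  linarith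

end DoublyStochastic

end Mixing

/-! ### Lipschitz gradients from the quadratic upper bound on a convex set. -/

section SmoothConvex

variable {E : Type*} [NormedAddCommGroup E] [InnerProductSpace ℝ E]

/-- `X` contains the closed ball of radius `r` around `z` in the translate of `V` through `z`. -/
def RelBall (V : Submodule ℝ E) (X : Set E) (z : E) (r : ℝ) : Prop :=
  ∀ u ∈ V, ‖u‖ ≤ r → z + u ∈ X

/-- `φ` is an `L`-Lipschitz convex function on `X` with gradient map `g`, and satisfies the
quadratic upper bound with constant `G` on `X`. -/
structure SmoothConvexOn (X : Set E) (φ : E → ℝ) (g : E → E) (L G : ℝ) : Prop where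
  lower : ∀ x ∈ X, ∀ z ∈ X, φ z + inner ℝ (g z) (x - z) ≤ φ x
  upper : ∀ x ∈ X, ∀ z ∈ X, φ x - φ z ≤ inner ℝ (g z) (x - z) + G / 2 * ‖x - z‖ ^ 2
  lipschitz : ∀ x ∈ X, ∀ z ∈ X, |φ x - φ z| ≤ L * ‖x - z‖

variable {V : Submodule ℝ E} {X : Set E} {φ : E → ℝ} {g : E → E} {L G : ℝ}

lemma RelBall.mono {z : E} {r s : ℝ} (h : RelBall V X z r) (hs : s ≤ r) : RelBall V X z s :=
  fun u hu hus => h u hu (hus.trans hs)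

lemma RelBall.mem {z : E} {r : ℝ} (h : RelBall V X z r) (hr : 0 ≤ r) : z ∈ X := by
  simpa using h 0 V.zero_mem (by simpa using hr)

lemma RelBall.lineMap (hX : Convex ℝ X) {y z : E} {r s : ℝ} (hy : RelBall V X y r)
    (hz : RelBall V X z r) (hs : s ∈ Set.Icc (0 : ℝ) 1) :
    RelBall V X (AffineMap.lineMap y z s) r := by
  intro u hu hur
  have := hX.lineMap_mem (hy u hu hur) (hz u hu hur) hs
  convert this using 1
  simp only [AffineMap.lineMap_apply_module]
  module

lemma RelBall.lineMap_of_mem (hX : Convex ℝ X) {y w : E} {r s : ℝ} (hy : y ∈ X)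
    (hw : RelBall V X w r) (hs : s ∈ Set.Ioc (0 : ℝ) 1) :
    RelBall V X (AffineMap.lineMap y w s) (s * r) := by
  intro u hu hur
  have hs0 := hs.1
  have h1 : w + s⁻¹ • u ∈ X := by
    refine hw _ (V.smul_mem _ hu) ?_
    rw [norm_smul, Real.norm_of_nonneg (by positivity), inv_mul_le_iff₀ hs0]
    exact hur
  have := hX.lineMap_mem hy h1 ⟨hs0.le, hs.2⟩
  convert this using 1
  simp only [AffineMap.lineMap_apply_module, smul_add, smul_smul, mul_inv_cancel₀ hs0.ne']
  module

/-- A nonempty convex set in finite dimension has a relative interior point. -/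
lemma exists_relBall [FiniteDimensional ℝ E] (hX : Convex ℝ X) (hne : X.Nonempty) :
    ∃ w r, 0 < r ∧ RelBall (vectorSpan ℝ X) X w r := by
  obtain ⟨_, ⟨w, hw, rfl⟩⟩ := hne.intrinsicInterior hX
  obtain ⟨r, hr, hball⟩ := Metric.isOpen_iff.1 isOpen_interior w hw
  refine ⟨w, r / 2, by positivity, fun u hu hur => ?_⟩
  have hmem : (w : E) + u ∈ affineSpan ℝ X := by
    rw [add_comm]
    refine AffineSubspace.vadd_mem_of_mem_direction ?_ w.2
    rwa [direction_affineSpan]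
  have : (⟨(w : E) + u, hmem⟩ : affineSpan ℝ X) ∈ Metric.ball w r := by
    rw [Metric.mem_ball, Subtype.dist_eq]
    simp only [dist_self_add_left]
    linarith
  exact interior_subset (s := ((↑) : affineSpan ℝ X → E) ⁻¹' X) (hball this)

/-- The test point at distance `ε` from `z` against `g z - g y` is feasible. Comparing the convexity
bound from `y` there with the upper bounds from `z` to it and from `y` to `z` isolates `‖g z - g
y‖`. Only `z` needs room around it; `y` may lie on the boundary. -/
lemma SmoothConvexOn.mul_norm_sub_le (h : SmoothConvexOn X φ g L G) (hg : ∀ z, g z ∈ V)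
    (hG : 0 ≤ G) {y z : E} (hy : y ∈ X) {ε : ℝ} (hε : 0 ≤ ε) (hz : RelBall V X z ε) :
    ε * ‖g z - g y‖ ≤ G / 2 * (ε ^ 2 + ‖z - y‖ ^ 2) := by
  have hzX := hz.mem hε
  have hup := h.upper z hzX y hy
  rcases eq_or_ne (g z - g y) 0 with h0 | h0
  · rw [h0, norm_zero, mul_zero]
    positivity
  · have hu : 0 < ‖g z - g y‖ := norm_pos_iff.2 h0
    set s : ℝ := ε / ‖g z - g y‖ with hs
    have hsn : ‖-(s • (g z - g y))‖ = ε := by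
      rw [norm_neg, norm_smul, Real.norm_of_nonneg (by positivity), hs]
      field_simp
    have hx := hz _ (V.neg_mem (V.smul_mem s (V.sub_mem (hg z) (hg y)))) hsn.le
    set x := z + -(s • (g z - g y)) with hxdef
    have h1 := h.lower x hx y hy
    have h2 := h.upper x hx z hzX
    have hxz : x - z = -(s • (g z - g y)) := by simp [hxdef]
    rw [hxz, hsn] at h2
    have h3 : inner ℝ (g y) (x - y) = inner ℝ (g y) (z - y) - s * inner ℝ (g y) (g z - g y) := by
      rw [hxdef, show z + -(s • (g z - g y)) - y = (z - y) - s • (g z - g y) by abel,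
        inner_sub_right, inner_smul_right]
    have h4 : inner ℝ (g z) (-(s • (g z - g y))) = - (s * inner ℝ (g z) (g z - g y)) := by
      rw [inner_neg_right, inner_smul_right]
    have h5 : s * inner ℝ (g z) (g z - g y) - s * inner ℝ (g y) (g z - g y)
        = ε * ‖g z - g y‖ := by
      rw [← mul_sub, ← inner_sub_left, real_inner_self_eq_norm_sq, hs]
      field_simp
    rw [h3] at h1
    rw [h4] at h2
    linarith

/-- Taking `ε = ‖z - y‖` in `mul_norm_sub_le` gives exactly the constant `G`. When the ball is too
small for that, the segment is cut into pieces shorter than `r`; every point on it still carries a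
ball of radius `r`. -/
lemma SmoothConvexOn.norm_sub_le_of_relBall (h : SmoothConvexOn X φ g L G) (hX : Convex ℝ X)
    (hg : ∀ z, g z ∈ V) (hG : 0 ≤ G) {y z : E} {r : ℝ} (hr : 0 < r) (hy : RelBall V X y r)
    (hz : RelBall V X z r) : ‖g z - g y‖ ≤ G * ‖z - y‖ := by
  rcases eq_or_ne z y with rfl | hne
  · simp
  have hδ : 0 < ‖z - y‖ := norm_pos_iff.2 (sub_ne_zero.2 hne)
  obtain ⟨N, hN⟩ := exists_nat_gt (‖z - y‖ / r)
  have hN0 : (0 : ℝ) < N := lt_trans (by positivity) hN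
  have hstep : ‖z - y‖ / N ≤ r := by
    rw [div_le_iff₀ hN0]
    rw [div_lt_iff₀ hr] at hN
    linarith
  let c : ℕ → E := fun k => AffineMap.lineMap y z ((k : ℝ) / N)
  have hc : ∀ k : ℕ, k ≤ N → RelBall V X (c k) r := fun k hk => by
    refine hy.lineMap hX hz ⟨by positivity, ?_⟩
    rw [div_le_one hN0]
    exact_mod_cast hk
  have hdist : ∀ k, ‖c (k + 1) - c k‖ = ‖z - y‖ / N := by
    intro k
    have : c (k + 1) - c k = (1 / (N : ℝ)) • (z - y) := by
      simp only [c, AffineMap.lineMap_apply_module']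
      push_cast
      rw [add_div]
      module
    rw [this, norm_smul, Real.norm_of_nonneg (by positivity)]
    ring
  have key : ∀ k : ℕ, k ≤ N → ‖g (c k) - g (c 0)‖ ≤ k * (G * (‖z - y‖ / N)) := by
    intro k
    induction k with
    | zero => simp
    | succ k ih =>
      intro hk
      have h1 := ih (by omega)
      have h2 := h.mul_norm_sub_le hg hG ((hc k (by omega)).mem hr.le) (ε := ‖z - y‖ / N)
        (by positivity) ((hc (k + 1) hk).mono hstep)
      rw [hdist] at h2
      have h3 : ‖g (c (k + 1)) - g (c k)‖ ≤ G * (‖z - y‖ / N) := by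
        refine le_of_mul_le_mul_left ?_ (show 0 < ‖z - y‖ / N by positivity)
        linarith
      have := norm_sub_le_norm_sub_add_norm_sub (g (c (k + 1))) (g (c k)) (g (c 0))
      push_cast
      linarith
  have hfin := key N le_rfl
  have e1 : c N = z := by simp [c, div_self hN0.ne']
  have e0 : c 0 = y := by simp [c]
  rw [e1, e0] at hfin
  refine hfin.trans (le_of_eq ?_)
  field_simp

/-- A convex function with the quadratic upper bound on a convex set has a gradient that is
Lipschitz on the whole set, with the same constant, in the directions of the set. -/
lemma SmoothConvexOn.norm_sub_le (h : SmoothConvexOn X φ g L G) (hX : Convex ℝ X)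
    (hg : ∀ z, g z ∈ V) (hG : 0 ≤ G) {w : E} {r : ℝ} (hr : 0 < r) (hw : RelBall V X w r)
    {y z : E} (hy : y ∈ X) (hz : z ∈ X) : ‖g z - g y‖ ≤ G * ‖z - y‖ := by
  -- Moving the fraction `s` towards `w` gives a ball of radius `s * r` after a displacement `s * ‖w
  -- - x‖`. Both scale with `s`, so the gradient changes by `O(s)` even from a boundary point;
  -- below, `s` is made arbitrarily small.
  have near : ∀ x ∈ X, ∀ s ∈ Set.Ioc (0 : ℝ) 1, ‖g (AffineMap.lineMap x w s) - g x‖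
      ≤ s * (G / 2 * (r ^ 2 + ‖w - x‖ ^ 2) / r) := by
    intro x hx s hs
    have hs0 := hs.1
    have h1 := h.mul_norm_sub_le hg hG hx (by positivity) (hw.lineMap_of_mem hX hx hs)
    have h2 : ‖(AffineMap.lineMap x w s : E) - x‖ = s * ‖w - x‖ := by
      rw [AffineMap.lineMap_apply_module', add_sub_cancel_right, norm_smul,
        Real.norm_of_nonneg hs0.le]
    rw [h2] at h1
    refine le_of_mul_le_mul_left (h1.trans (le_of_eq ?_)) (mul_pos hs0 hr)
    field_simp
  set K : ℝ := G / 2 * (r ^ 2 + ‖w - y‖ ^ 2) / r + G / 2 * (r ^ 2 + ‖w - z‖ ^ 2) / r with hK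
  have hK0 : 0 ≤ K := by positivity
  refine le_of_forall_pos_le_add fun e he => ?_
  set s : ℝ := min 1 (e / (K + 1)) with hs
  have hs0 : 0 < s := lt_min one_pos (by positivity)
  have hs1 : s ≤ 1 := min_le_left _ _
  have hsK : s * K ≤ e := by
    have : s * (K + 1) ≤ e := by
      rw [← le_div_iff₀ (by positivity)]
      exact min_le_right _ _
    linarith
  have hy' := near y hy s ⟨hs0, hs1⟩
  have hz' := near z hz s ⟨hs0, hs1⟩
  have hmid := h.norm_sub_le_of_relBall hX hg hG (mul_pos hs0 hr)
    (hw.lineMap_of_mem hX hy ⟨hs0, hs1⟩) (hw.lineMap_of_mem hX hz ⟨hs0, hs1⟩)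
  have hlen : ‖(AffineMap.lineMap z w s : E) - AffineMap.lineMap y w s‖ ≤ ‖z - y‖ := by
    have : (AffineMap.lineMap z w s : E) - AffineMap.lineMap y w s = (1 - s) • (z - y) := by
      simp only [AffineMap.lineMap_apply_module]
      module
    rw [this, norm_smul, Real.norm_of_nonneg (by linarith)]
    exact mul_le_of_le_one_left (norm_nonneg _) (by linarith)
  have hmid' := hmid.trans (mul_le_mul_of_nonneg_left hlen hG)
  have t1 := norm_sub_le_norm_sub_add_norm_sub (g z) (g (AffineMap.lineMap z w s)) (g y)
  have t2 := norm_sub_le_norm_sub_add_norm_sub (g (AffineMap.lineMap z w s))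
    (g (AffineMap.lineMap y w s)) (g y)
  rw [norm_sub_rev (g z) (g (AffineMap.lineMap z w s))] at t1
  have : s * K = s * (G / 2 * (r ^ 2 + ‖w - y‖ ^ 2) / r)
      + s * (G / 2 * (r ^ 2 + ‖w - z‖ ^ 2) / r) := by rw [hK]; ring
  linarith

/-- A step of length `r` along the gradient raises `φ` by at least `r * ‖g w‖` by convexity, and by
at most `L * r`. -/
lemma SmoothConvexOn.norm_le_of_relBall (h : SmoothConvexOn X φ g L G) (hg : ∀ z, g z ∈ V)
    (hL : 0 ≤ L) {w : E} {r : ℝ} (hr : 0 < r) (hw : RelBall V X w r) : ‖g w‖ ≤ L := by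
  rcases eq_or_ne (g w) 0 with h0 | h0
  · simpa [h0] using hL
  have hu : 0 < ‖g w‖ := norm_pos_iff.2 h0
  have hn : ‖(r / ‖g w‖) • g w‖ = r := by
    rw [norm_smul, Real.norm_of_nonneg (by positivity)]
    field_simp
  have hx := hw _ (V.smul_mem (r / ‖g w‖) (hg w)) hn.le
  have h1 := h.lower _ hx w (hw.mem hr.le)
  have h2 := (le_abs_self _).trans (h.lipschitz _ hx w (hw.mem hr.le))
  rw [add_sub_cancel_left] at h1 h2
  rw [hn] at h2
  rw [inner_smul_right, real_inner_self_eq_norm_sq] at h1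
  have h3 : r / ‖g w‖ * ‖g w‖ ^ 2 = r * ‖g w‖ := by field_simp
  rw [h3] at h1
  refine le_of_mul_le_mul_left ?_ hr
  linarith

/-- The bound at `w` is transported by the Lipschitz property, so the bound does not depend on `w`,
`r` or the dimension. -/
lemma SmoothConvexOn.norm_le (h : SmoothConvexOn X φ g L G) (hX : Convex ℝ X)
    (hg : ∀ z, g z ∈ V) (hL : 0 ≤ L) (hG : 0 ≤ G) {w : E} {r : ℝ} (hr : 0 < r)
    (hw : RelBall V X w r) {M : ℝ} (hM : ∀ x ∈ X, ∀ z ∈ X, ‖x - z‖ ≤ M) {z : E} (hz : z ∈ X) :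
    ‖g z‖ ≤ L + G * M := by
  have h1 := h.norm_sub_le hX hg hG hr hw (hw.mem hr.le) hz
  have h2 := mul_le_mul_of_nonneg_left (hM z hz w (hw.mem hr.le)) hG
  have h3 := h.norm_le_of_relBall hg hL hr hw
  have h4 := norm_le_norm_add_norm_sub' (g z) (g w)
  linarith

/-- The first-order characterisation of convexity at a point of differentiability. -/
lemma add_inner_gradient_le [CompleteSpace E] (hφ : ConvexOn ℝ X φ) {x z : E}
    (hx : x ∈ X) (hz : z ∈ X) (hd : DifferentiableAt ℝ φ z) :
    φ z + inner ℝ (gradient φ z) (x - z) ≤ φ x := by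
  have hcomp := hφ.comp_affineMap (AffineMap.lineMap z x : ℝ →ᵃ[ℝ] E)
  have hder : HasDerivAt (φ ∘ (AffineMap.lineMap z x : ℝ →ᵃ[ℝ] E))
      (inner ℝ (gradient φ z) (x - z)) 0 := by
    have h1 : HasFDerivAt φ (InnerProductSpace.toDual ℝ E (gradient φ z))
        ((AffineMap.lineMap z x : ℝ →ᵃ[ℝ] E) 0) := by
      rw [AffineMap.lineMap_apply_zero]
      exact hasGradientAt_iff_hasFDerivAt.1 hd.hasGradientAt
    exact h1.comp_hasDerivAt 0 AffineMap.hasDerivAt_lineMap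
  have := hcomp.le_slope_of_hasDerivAt (x := 0) (y := 1) (by simpa using hz) (by simpa using hx)
    one_pos hder
  simp only [slope_def_field, Function.comp_apply, AffineMap.lineMap_apply_one,
    AffineMap.lineMap_apply_zero, sub_zero, div_one] at this
  linarith

/-- Permits replacing gradients by their projections in convexity, smoothness and oracle optimality,
where they are only paired with differences of feasible points. -/
lemma inner_starProjection_sub [V.HasOrthogonalProjection] (b : E) {u : E} (hu : u ∈ V) :
    inner ℝ (V.starProjection b) u = inner ℝ b u := by
  rw [Submodule.inner_starProjection_left_eq_right, Submodule.starProjection_eq_self_iff.2 hu]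

end SmoothConvex

/-! ### A Lyapunov function for the coupled recursion. -/

/-- The error constant of a recursion coupled with two contracted error sequences. -/
noncomputable def recursionConst (σ c : ℝ) : ℝ :=
  let b := c / (1 - σ)
  let a := (c + b * c) / (1 - σ)
  a * c + b * ((c ^ 2 + 2 * c) / (1 - σ)) + c + a * c + b * c

lemma recursionConst_nonneg {σ c : ℝ} (hσ1 : σ < 1) (hc : 0 ≤ c) : 0 ≤ recursionConst σ c := by
  have : 0 < 1 - σ := by linarith
  unfold recursionConst
  positivity

/-- A quantity `h` that contracts by `1 - α` up to errors `α * (p + q)` and `α ^ 2`, where `p` and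
`q` contract by `σ` up to errors of order `α`, is `O(α)` after `k` steps with `α * k ≤ 1`. -/
lemma coupled_recursion_le {σ c α : ℝ} (hσ : 0 ≤ σ) (hσ1 : σ < 1) (hc : 0 ≤ c) (hα : 0 ≤ α)
    (hα1 : α ≤ 1) {h p q : ℕ → ℝ} (hp0 : ∀ k, 0 ≤ p k) (hq0 : ∀ k, 0 ≤ q k)
    (hpc : ∀ k, p k ≤ c) (hqc : q 0 ≤ c)
    (hh : ∀ k, h (k + 1) ≤ (1 - α) * h k + α * (c * (p k + q k)) + c * α ^ 2)
    (hp : ∀ k, p (k + 1) ≤ σ * p k + c * α)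
    (hq : ∀ k, q (k + 1) ≤ σ * q k + c * p k + c * α) (k : ℕ) (hk : α * k ≤ 1) :
    h k ≤ (1 - α) ^ k * h 0 + 2 * recursionConst σ c * α := by
  have hs : 0 < 1 - σ := by linarith
  -- The weights `a`, `b` are chosen so that the contraction of `a * p + b * q` pays exactly for the
  -- term `c * (p + q)` in the recursion of `h` and the coupling `c * p` in that of `q`.
  set b := c / (1 - σ) with hb
  set a := (c + b * c) / (1 - σ) with ha
  have hb0 : 0 ≤ b := by positivity
  have ha0 : 0 ≤ a := by positivity
  have hbσ : b * (1 - σ) = c := div_mul_cancel₀ _ hs.ne'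
  have haσ : a * (1 - σ) = c + b * c := div_mul_cancel₀ _ hs.ne'
  set C := recursionConst σ c with hC
  have hCdef : C = a * c + b * ((c ^ 2 + 2 * c) / (1 - σ)) + c + a * c + b * c := rfl
  have hC0 : 0 ≤ C := recursionConst_nonneg hσ1 hc
  set B := (c ^ 2 + 2 * c) / (1 - σ) with hB
  have hB0 : 0 ≤ B := by positivity
  have hBσ : B * (1 - σ) = c ^ 2 + 2 * c := div_mul_cancel₀ _ hs.ne'
  have hqB : ∀ k, q k ≤ B := by
    intro k
    induction k with
    | zero =>
      refine hqc.trans ?_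
      rw [hB, le_div_iff₀ hs]
      nlinarith [mul_nonneg hc hσ]
    | succ k ih =>
      have h1 := mul_le_mul_of_nonneg_left ih hσ
      have h2 := mul_le_mul_of_nonneg_left (hpc k) hc
      have h3 := mul_le_mul_of_nonneg_left hα1 hc
      have h4 := hq k
      nlinarith
  have hpq : ∀ k, a * p k + b * q k ≤ a * c + b * B := fun k =>
    add_le_add (mul_le_mul_of_nonneg_left (hpc k) ha0) (mul_le_mul_of_nonneg_left (hqB k) hb0)
  set Φ : ℕ → ℝ := fun k => h k + α * (a * p k + b * q k) with hΦ
  have hstep : ∀ k, Φ (k + 1) ≤ (1 - α) * Φ k + α ^ 2 * C := by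
    intro k
    have h1 : α * (a * p (k + 1) + b * q (k + 1))
        ≤ α * (a * (σ * p k + c * α) + b * (σ * q k + c * p k + c * α)) :=
      mul_le_mul_of_nonneg_left (add_le_add (mul_le_mul_of_nonneg_left (hp k) ha0)
        (mul_le_mul_of_nonneg_left (hq k) hb0)) hα
    have h2 : c * (p k + q k) + (a * (σ * p k + c * α) + b * (σ * q k + c * p k + c * α))
        = a * p k + b * q k + α * (a * c + b * c) := by
      linear_combination (-p k) * haσ - q k * hbσ
    -- Asking `Φ` to decay by `1 - α` leaves `α` times its error part, which is of second order
    -- because `p` and `q` are bounded.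
    have h3 : α ^ 2 * (a * p k + b * q k) ≤ α ^ 2 * (a * c + b * B) :=
      mul_le_mul_of_nonneg_left (hpq k) (sq_nonneg α)
    calc Φ (k + 1)
        ≤ (1 - α) * h k + c * α ^ 2 + α * (c * (p k + q k)
            + (a * (σ * p k + c * α) + b * (σ * q k + c * p k + c * α))) := by
          simp only [hΦ]
          linarith [hh k]
      _ = (1 - α) * Φ k + α ^ 2 * (a * p k + b * q k) + α ^ 2 * (c + a * c + b * c) := by
          rw [h2]
          simp only [hΦ]
          ring
      _ ≤ (1 - α) * Φ k + α ^ 2 * C := by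
          rw [hCdef]
          linarith
  have hind : ∀ k : ℕ, Φ k ≤ (1 - α) ^ k * Φ 0 + k * (α ^ 2 * C) := by
    intro k
    induction k with
    | zero => simp
    | succ k ih =>
      have h1 := mul_le_mul_of_nonneg_left ih (sub_nonneg.2 hα1)
      have h2 : (1 - α) * (k * (α ^ 2 * C)) ≤ k * (α ^ 2 * C) :=
        mul_le_of_le_one_left (by positivity) (by linarith)
      have h3 := hstep k
      push_cast
      rw [pow_succ]
      linarith
  have h1 : h k ≤ Φ k := by
    have : 0 ≤ α * (a * p k + b * q k) :=
      mul_nonneg hα (add_nonneg (mul_nonneg ha0 (hp0 k)) (mul_nonneg hb0 (hq0 k)))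
    simp only [hΦ]
    linarith
  have h2 : Φ 0 ≤ h 0 + α * C := by
    have : a * p 0 + b * q 0 ≤ C := by
      refine (hpq 0).trans ?_
      rw [hCdef]
      nlinarith [mul_nonneg ha0 hc, mul_nonneg hb0 hc]
    simp only [hΦ]
    linarith [mul_le_mul_of_nonneg_left this hα]
  have h3 : (1 - α) ^ k * Φ 0 ≤ (1 - α) ^ k * h 0 + α * C := by
    have e0 : 0 ≤ (1 - α) ^ k := pow_nonneg (by linarith) k
    have e1 : (1 - α) ^ k ≤ 1 := pow_le_one₀ (by linarith) (by linarith)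
    have := mul_le_mul_of_nonneg_left h2 e0
    have := mul_le_of_le_one_left (mul_nonneg hα hC0) e1
    linarith
  -- The condition `α * k ≤ 1` turns `k` errors of order `α ^ 2` into one of order `α`.
  have h4 : k * (α ^ 2 * C) ≤ α * C := by
    have := mul_le_mul_of_nonneg_right hk (mul_nonneg hα hC0)
    nlinarith
  linarith [hind k]

/-! ### One round: inexact Frank-Wolfe for the averaged point. -/

section Round

variable {ι E : Type*} [Fintype ι] [NormedAddCommGroup E] [InnerProductSpace ℝ E]

/-- A run of distributed Frank-Wolfe with gradient tracking: `x k` are the points before the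
inner iteration `k`, `y k` the gradient estimates and `v k` the oracle answers in it. -/
structure TrackingRun (A : Matrix ι ι ℝ) (X : Set E) (g : ι → E → E) (α : ℝ)
    (x y v : ℕ → ι → E) : Prop where
  x_zero_mem : ∀ i, x 0 i ∈ X
  v_mem : ∀ k i, v k i ∈ X
  v_le : ∀ k i, ∀ z ∈ X, inner ℝ (v k i) (y k i) ≤ inner ℝ z (y k i)
  x_succ : ∀ k, x (k + 1) = mix A (x k) + α • (v k - mix A (x k))
  y_zero : y 0 = mix A fun i => g i (mix A (x 0) i)
  y_succ : ∀ k, y (k + 1) = mix A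
    (y k + (fun i => g i (mix A (x (k + 1)) i)) - fun i => g i (mix A (x k) i))

namespace TrackingRun

variable [DecidableEq ι] [Nonempty ι] {A : Matrix ι ι ℝ} {X : Set E} {φ : ι → E → ℝ}
  {g : ι → E → E} {α L G M B σ : ℝ} {x y v : ℕ → ι → E}

lemma x_mem (R : TrackingRun A X g α x y v) (hA : A ∈ doublyStochastic ℝ ι) (hX : Convex ℝ X)
    (hα : 0 ≤ α) (hα1 : α ≤ 1) (k : ℕ) (i : ι) : x k i ∈ X := by
  induction k generalizing i with
  | zero => exact R.x_zero_mem i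
  | succ k ih =>
    rw [R.x_succ]
    exact hX.add_smul_sub_mem (mix_mem hA hX ih i) (R.v_mem k i) ⟨hα, hα1⟩

/-- The tracking invariant: mixing preserves means, and the gradient increments telescope. -/
lemma avg_y (R : TrackingRun A X g α x y v) (hA : A ∈ doublyStochastic ℝ ι) (k : ℕ) :
    avg (y k) = avg fun i => g i (mix A (x k) i) := by
  induction k with
  | zero => rw [R.y_zero, avg_mix hA]
  | succ k ih => rw [R.y_succ, avg_mix hA, avg_sub, avg_add, ih]; abel

lemma avg_x_succ (R : TrackingRun A X g α x y v) (hA : A ∈ doublyStochastic ℝ ι) (k : ℕ) :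
    avg (x (k + 1)) = avg (x k) + α • (avg (v k) - avg (x k)) := by
  rw [R.x_succ, avg_add, avg_smul, avg_sub, avg_mix hA]

/-- The new points are a convex combination of mixed points, whose dispersion contracts, and of
feasible oracle answers with weight `α`, whose dispersion is at most `card ι * M`. -/
lemma disp_x_succ_le (R : TrackingRun A X g α x y v) (hX : Convex ℝ X) (hM : 0 ≤ M)
    (hdiam : ∀ x ∈ X, ∀ z ∈ X, ‖x - z‖ ≤ M) (hα : 0 ≤ α) (hα1 : α ≤ 1)
    (hmix : ∀ x : ι → E, disp (mix A x) ≤ σ * disp x) (k : ℕ) :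
    disp (x (k + 1)) ≤ σ * disp (x k) + Fintype.card ι * M * α := by
  have h : x (k + 1) = (1 - α) • mix A (x k) + α • v k := by
    rw [R.x_succ]
    module
  rw [h]
  refine (disp_add_le _ _).trans ?_
  rw [disp_smul, disp_smul, abs_of_nonneg hα, abs_of_nonneg (by linarith : 0 ≤ 1 - α)]
  have h1 := mul_le_mul_of_nonneg_left (disp_le_of_diam hX hM hdiam (R.v_mem k)) hα
  have h2 : (1 - α) * disp (mix A (x k)) ≤ disp (mix A (x k)) :=
    mul_le_of_le_one_left (disp_nonneg _) (by linarith)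
  linarith [hmix (x k)]

lemma disp_y_zero_le (R : TrackingRun A X g α x y v) (hA : A ∈ doublyStochastic ℝ ι)
    (hX : Convex ℝ X) (hB : 0 ≤ B) (hg : ∀ i, ∀ z ∈ X, ‖g i z‖ ≤ B) :
    disp (y 0) ≤ Fintype.card ι * B := by
  rw [R.y_zero]
  refine (disp_le_norm2 _).trans ((norm2_mix_le hA _).trans (norm2_le_card_mul hB fun i => ?_))
  exact hg i _ (mix_mem hA hX R.x_zero_mem i)

/-- The displacement splits into a consensus move, bounded by the dispersion, and a Frank-Wolfe step
of order `α`. It drives the gradient increments in `disp_y_succ_le`. -/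
lemma norm2_mix_succ_sub_le (R : TrackingRun A X g α x y v) (hA : A ∈ doublyStochastic ℝ ι)
    (hX : Convex ℝ X) (hM : 0 ≤ M) (hdiam : ∀ x ∈ X, ∀ z ∈ X, ‖x - z‖ ≤ M) (hα : 0 ≤ α)
    (hα1 : α ≤ 1) (k : ℕ) :
    norm2 (mix A (x (k + 1)) - mix A (x k))
      ≤ 2 * disp (x (k + 1)) + Fintype.card ι * M * α := by
  have h : mix A (x (k + 1)) - mix A (x k)
      = (mix A (x (k + 1)) - x (k + 1)) + α • (v k - mix A (x k)) := by
    nth_rewrite 3 [R.x_succ k]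
    abel
  rw [h]
  refine (norm2_add_le _ _).trans (add_le_add (norm2_mix_sub_le hA _) ?_)
  rw [norm2_smul, abs_of_nonneg hα, mul_comm]
  refine mul_le_mul_of_nonneg_right (norm2_le_card_mul hM fun i => ?_) hα
  exact hdiam _ (R.v_mem k i) _ (mix_mem hA hX (R.x_mem hA hX hα hα1 k) i)

lemma disp_y_succ_le (R : TrackingRun A X g α x y v) (hA : A ∈ doublyStochastic ℝ ι)
    (hX : Convex ℝ X) (hM : 0 ≤ M) (hdiam : ∀ x ∈ X, ∀ z ∈ X, ‖x - z‖ ≤ M) (hα : 0 ≤ α)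
    (hα1 : α ≤ 1) (hσ : 0 ≤ σ) (hσ1 : σ ≤ 1)
    (hmix : ∀ x : ι → E, disp (mix A x) ≤ σ * disp x) (hG : 0 ≤ G)
    (hg : ∀ i, ∀ y ∈ X, ∀ z ∈ X, ‖g i z - g i y‖ ≤ G * ‖z - y‖) (k : ℕ) :
    disp (y (k + 1)) ≤ σ * disp (y k) + 2 * G * disp (x k)
      + 3 * (G * (Fintype.card ι * M)) * α := by
  have hxm := R.x_mem hA hX hα hα1
  set Δ : ι → E := (fun i => g i (mix A (x (k + 1)) i)) - fun i => g i (mix A (x k) i) with hΔ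
  have h1 : disp Δ ≤ G * (2 * disp (x (k + 1)) + Fintype.card ι * M * α) := by
    refine (disp_le_norm2 _).trans ?_
    refine le_trans ?_ (mul_le_mul_of_nonneg_left
      (R.norm2_mix_succ_sub_le hA hX hM hdiam hα hα1 k) hG)
    exact norm2_le_of_norm_le hG fun i =>
      hg i _ (mix_mem hA hX (hxm k) i) _ (mix_mem hA hX (hxm (k + 1)) i)
  have h2 : disp (x (k + 1)) ≤ disp (x k) + Fintype.card ι * M * α :=
    (R.disp_x_succ_le hX hM hdiam hα hα1 hmix k).trans
      (add_le_add_left (mul_le_of_le_one_left (disp_nonneg _) hσ1) _)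
  have h3 : disp (y (k + 1)) ≤ σ * (disp (y k) + disp Δ) := by
    rw [R.y_succ, add_sub_assoc]
    exact (hmix _).trans (mul_le_mul_of_nonneg_left (disp_add_le _ _) hσ)
  have h4 : σ * disp Δ ≤ disp Δ := mul_le_of_le_one_left (disp_nonneg _) hσ1
  have h5 := mul_le_mul_of_nonneg_left h2 hG
  linarith

/-- One Frank-Wolfe step along the averaged oracle answers. -/
lemma sum_avg_succ_le (R : TrackingRun A X g α x y v) (hA : A ∈ doublyStochastic ℝ ι)
    (hX : Convex ℝ X) (hdiam : ∀ x ∈ X, ∀ z ∈ X, ‖x - z‖ ≤ M) (hα : 0 ≤ α)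
    (hα1 : α ≤ 1) (hσ1 : σ ≤ 1)
    (hmix : ∀ x : ι → E, disp (mix A x) ≤ σ * disp x) (hG : 0 ≤ G)
    (hφ : ∀ i, SmoothConvexOn X (φ i) (g i) L G)
    (hg : ∀ i, ∀ y ∈ X, ∀ z ∈ X, ‖g i z - g i y‖ ≤ G * ‖z - y‖) {z : E} (hz : z ∈ X) (k : ℕ) :
    ∑ i, φ i (avg (x (k + 1))) - ∑ i, φ i z
      ≤ (1 - α) * (∑ i, φ i (avg (x k)) - ∑ i, φ i z)
        + α * (Fintype.card ι * M * (disp (y k) + G * disp (x k)))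
        + Fintype.card ι * G * M ^ 2 / 2 * α ^ 2 := by
  have hxm := R.x_mem hA hX hα hα1
  set m : ℝ := (Fintype.card ι : ℝ) with hm
  have hm0 : 0 < m := by rw [hm]; exact_mod_cast Fintype.card_pos
  set u : E := avg (x k) with hu
  have huX : u ∈ X := avg_mem hX (hxm k)
  have hvX : avg (v k) ∈ X := avg_mem hX (R.v_mem k)
  set Γ : E := ∑ i, g i u with hΓ
  have hconv : ∑ i, φ i u + inner ℝ Γ (z - u) ≤ ∑ i, φ i z := by
    rw [hΓ, sum_inner, ← Finset.sum_add_distrib]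
    exact Finset.sum_le_sum fun i _ => (hφ i).lower z hz u huX
  have hsmooth : ∑ i, φ i (avg (x (k + 1))) - ∑ i, φ i u
      ≤ α * inner ℝ Γ (avg (v k) - u) + m * G * M ^ 2 / 2 * α ^ 2 := by
    have hterm : ∀ i, φ i (avg (x (k + 1))) - φ i u
        ≤ α * inner ℝ (g i u) (avg (v k) - u) + G * M ^ 2 / 2 * α ^ 2 := by
      intro i
      have h1 := (hφ i).upper _ (avg_mem hX (hxm (k + 1))) u huX
      have h2 : avg (x (k + 1)) - u = α • (avg (v k) - u) := by
        rw [R.avg_x_succ hA, ← hu, add_sub_cancel_left]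
      rw [h2, inner_smul_right, norm_smul, Real.norm_of_nonneg hα, mul_pow] at h1
      have h3 : ‖avg (v k) - u‖ ^ 2 ≤ M ^ 2 :=
        pow_le_pow_left₀ (norm_nonneg _) (hdiam _ hvX _ huX) 2
      have h4 : G / 2 * (α ^ 2 * ‖avg (v k) - u‖ ^ 2) ≤ G / 2 * (α ^ 2 * M ^ 2) := by gcongr
      linarith
    calc _ = ∑ i, (φ i (avg (x (k + 1))) - φ i u) := by rw [Finset.sum_sub_distrib]
      _ ≤ ∑ i, (α * inner ℝ (g i u) (avg (v k) - u) + G * M ^ 2 / 2 * α ^ 2) :=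
        Finset.sum_le_sum fun i _ => hterm i
      _ = _ := by
        rw [Finset.sum_add_distrib, ← Finset.mul_sum, ← sum_inner, Finset.sum_const,
          Finset.card_univ, nsmul_eq_mul]
        ring
  -- By `avg_y`, the mean estimate uses gradients at the mixed points; Lipschitz continuity moves
  -- them all to the mean point `u`.
  have htrack : ‖avg (y k) - m⁻¹ • Γ‖ ≤ G * disp (x k) := by
    have h1 : m⁻¹ • Γ = avg fun i => g i u := rfl
    rw [h1, R.avg_y hA, ← avg_sub]
    refine norm_avg_le fun i => ?_
    refine (hg i _ huX _ (mix_mem hA hX (hxm k) i)).trans (mul_le_mul_of_nonneg_left ?_ hG)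
    have h2 := norm_sub_avg_le_disp (mix A (x k)) i
    rw [avg_mix hA] at h2
    exact h2.trans ((hmix _).trans (mul_le_of_le_one_left (disp_nonneg _) hσ1))
  -- The estimates track the mean gradient whereas `Γ` is the sum, hence the factor `m`.
  have herr : ∀ i, ‖m • y k i - Γ‖ ≤ m * (disp (y k) + G * disp (x k)) := by
    intro i
    have h1 : m • y k i - Γ = m • (y k i - m⁻¹ • Γ) := by
      rw [smul_sub, smul_inv_smul₀ hm0.ne']
    rw [h1, norm_smul, Real.norm_of_nonneg hm0.le]
    refine mul_le_mul_of_nonneg_left ?_ hm0.le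
    exact (norm_sub_le_norm_sub_add_norm_sub _ (avg (y k)) _).trans
      (add_le_add (norm_sub_avg_le_disp _ i) htrack)
  -- The oracle answer is exactly optimal for `y k i`, so it is optimal for `Γ` up to the direction
  -- error times the diameter.
  have hdir : ∀ i, inner ℝ Γ (v k i) ≤ inner ℝ Γ z + m * M * (disp (y k) + G * disp (x k)) := by
    intro i
    have h1 := mul_le_mul_of_nonneg_left (R.v_le k i z hz) hm0.le
    have h2 : inner ℝ (m • y k i - Γ) (z - v k i)
        ≤ m * (disp (y k) + G * disp (x k)) * M :=
      (real_inner_le_norm _ _).trans (mul_le_mul (herr i) (hdiam z hz _ (R.v_mem k i))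
        (norm_nonneg _) ((norm_nonneg _).trans (herr i)))
    rw [inner_sub_left, inner_sub_right, inner_sub_right, inner_smul_left, inner_smul_left,
      real_inner_comm z, real_inner_comm (v k i)] at h2
    simp only [conj_trivial] at h2
    linarith
  have hdir_avg : inner ℝ Γ (avg (v k)) ≤ inner ℝ Γ z + m * M * (disp (y k) + G * disp (x k)) := by
    rw [avg, inner_smul_right, inner_sum, inv_mul_le_iff₀ hm0]
    calc _ ≤ ∑ _i : ι, (inner ℝ Γ z + m * M * (disp (y k) + G * disp (x k))) :=
          Finset.sum_le_sum fun i _ => hdir i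
      _ = _ := by rw [Finset.sum_const, Finset.card_univ, nsmul_eq_mul]
  have hinner : inner ℝ Γ (avg (v k) - u)
      ≤ ∑ i, φ i z - ∑ i, φ i u + m * M * (disp (y k) + G * disp (x k)) := by
    rw [inner_sub_right] at hconv ⊢
    linarith
  have := mul_le_mul_of_nonneg_left hinner hα
  linarith

end TrackingRun

/-- The constant that controls all error terms within one round. -/
noncomputable def roundConst (m L G M : ℝ) : ℝ :=
  m * M + 3 * (G * (m * M)) + 2 * G + m * (L + G * M) + m * G * M ^ 2

/-- Progress of the averaged point in the optimality gap over one round. -/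
lemma TrackingRun.gap_le [DecidableEq ι] [Nonempty ι] {A : Matrix ι ι ℝ} {X : Set E}
    {φ : ι → E → ℝ} {g : ι → E → E} {α L G M σ : ℝ} {x y v : ℕ → ι → E}
    (R : TrackingRun A X g α x y v) (hA : A ∈ doublyStochastic ℝ ι)
    (hX : Convex ℝ X) (hM : 0 ≤ M) (hdiam : ∀ x ∈ X, ∀ z ∈ X, ‖x - z‖ ≤ M) (hα : 0 ≤ α)
    (hα1 : α ≤ 1) (hσ : 0 ≤ σ) (hσ1 : σ < 1)
    (hmix : ∀ x : ι → E, disp (mix A x) ≤ σ * disp x) (hL : 0 ≤ L) (hG : 0 ≤ G)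
    (hφ : ∀ i, SmoothConvexOn X (φ i) (g i) L G)
    (hg : ∀ i, ∀ y ∈ X, ∀ z ∈ X, ‖g i z - g i y‖ ≤ G * ‖z - y‖)
    (hgB : ∀ i, ∀ z ∈ X, ‖g i z‖ ≤ L + G * M) {z : E} (hz : z ∈ X) (k : ℕ) (hk : α * k ≤ 1) :
    ∑ i, φ i (avg (x k)) - ∑ i, φ i z
      ≤ (1 - α) ^ k * (∑ i, φ i (avg (x 0)) - ∑ i, φ i z)
        + 2 * recursionConst σ (roundConst (Fintype.card ι) L G M) * α := by
  set m : ℝ := (Fintype.card ι : ℝ) with hm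
  set c := roundConst m L G M with hc
  have hm0 : 0 ≤ m := by positivity
  have e1 : 0 ≤ m * M := by positivity
  have e2 : 0 ≤ G * (m * M) := by positivity
  have e3 : 0 ≤ m * (L + G * M) := by positivity
  have e4 : 0 ≤ m * G * M ^ 2 := by positivity
  have hcdef : c = m * M + 3 * (G * (m * M)) + 2 * G + m * (L + G * M) + m * G * M ^ 2 := rfl
  have hc0 : 0 ≤ c := by rw [hcdef]; linarith
  refine coupled_recursion_le (h := fun k => ∑ i, φ i (avg (x k)) - ∑ i, φ i z)
    (p := fun k => disp (x k)) (q := fun k => disp (y k)) hσ hσ1 hc0 hα hα1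
    (fun _ => disp_nonneg _) (fun _ => disp_nonneg _) (fun k => ?_) ?_ (fun k => ?_) (fun k => ?_)
    (fun k => ?_) k hk
  · refine (disp_le_of_diam hX hM hdiam (R.x_mem hA hX hα hα1 k)).trans ?_
    rw [hcdef]
    linarith
  · refine (R.disp_y_zero_le hA hX (by positivity) hgB).trans ?_
    rw [hcdef]
    linarith
  · have h1 := R.sum_avg_succ_le hA hX hdiam hα hα1 hσ1.le hmix hG hφ hg hz k
    have hp := disp_nonneg (x k)
    have hq := disp_nonneg (y k)
    have h2 : m * M * (disp (y k) + G * disp (x k)) ≤ c * (disp (x k) + disp (y k)) := by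
      have i1 : m * M * disp (y k) ≤ c * disp (y k) :=
        mul_le_mul_of_nonneg_right (by rw [hcdef]; linarith) hq
      have i2 : G * (m * M) * disp (x k) ≤ c * disp (x k) :=
        mul_le_mul_of_nonneg_right (by rw [hcdef]; linarith) hp
      linarith
    have h3 : m * G * M ^ 2 / 2 * α ^ 2 ≤ c * α ^ 2 :=
      mul_le_mul_of_nonneg_right (by rw [hcdef]; linarith) (sq_nonneg α)
    have h4 := mul_le_mul_of_nonneg_left h2 hα
    linarith
  · refine (R.disp_x_succ_le hX hM hdiam hα hα1 hmix k).trans (add_le_add_right ?_ _)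
    exact mul_le_mul_of_nonneg_right (by rw [hcdef]; linarith) hα
  · refine (R.disp_y_succ_le hA hX hM hdiam hα hα1 hσ hσ1.le hmix hG hg k).trans ?_
    refine add_le_add (add_le_add_right ?_ _) ?_
    · exact mul_le_mul_of_nonneg_right (by rw [hcdef]; linarith) (disp_nonneg _)
    · exact mul_le_mul_of_nonneg_right (by rw [hcdef]; linarith) hα

end Round

/-! ### Scalar summation estimates. -/

/-- Summing the recursion telescopes once the boundary term `r * s (m + 1)` is kept in the
induction; it is dropped only at the end, so just the last `s T` must be nonnegative. -/
lemma sum_le_of_contraction {r : ℝ} (hr : 0 ≤ r) (hr1 : r < 1) {s e : ℕ → ℝ}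
    {T : ℕ} (hT : 1 ≤ T) (hs : 0 ≤ s T)
    (h : ∀ t ∈ Finset.Icc 1 (T - 1), s (t + 1) ≤ r * s t + e t) :
    ∑ t ∈ Finset.Icc 1 T, s t ≤ (s 1 + ∑ t ∈ Finset.Icc 1 (T - 1), e t) / (1 - r) := by
  have key : ∀ m : ℕ, m + 1 ≤ T → (1 - r) * ∑ t ∈ Finset.Icc 1 (m + 1), s t + r * s (m + 1)
      ≤ s 1 + ∑ t ∈ Finset.Icc 1 m, e t := by
    intro m
    induction m with
    | zero =>
      intro _
      simp only [zero_add, Finset.Icc_self, Finset.sum_singleton]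
      simp
      linarith
    | succ m ih =>
      intro hm
      have h1 := ih (by omega)
      have h2 := h (m + 1) (Finset.mem_Icc.2 ⟨by omega, by omega⟩)
      rw [Finset.sum_Icc_succ_top (by omega : 1 ≤ m + 1 + 1) s,
        Finset.sum_Icc_succ_top (by omega : 1 ≤ m + 1) e]
      linarith
  obtain ⟨m, rfl⟩ : ∃ m, T = m + 1 := ⟨T - 1, by omega⟩
  rw [le_div_iff₀ (by linarith)]
  have h1 := key m le_rfl
  have h2 := mul_nonneg hr hs
  simp only [Nat.add_sub_cancel]
  linarith

/-- Each term is at most the increment of `t ^ (1 - γ) / (1 - γ)`, by Bernoulli's inequality for an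
exponent in `[0, 1]`. -/
lemma sum_rpow_neg_le {γ : ℝ} (hγ : 0 ≤ γ) (hγ1 : γ < 1) (T : ℕ) :
    ∑ t ∈ Finset.Icc 1 T, ((t : ℝ) ^ γ)⁻¹ ≤ (T : ℝ) ^ (1 - γ) / (1 - γ) := by
  have h1γ : 0 < 1 - γ := by linarith
  induction T with
  | zero => simp [Real.zero_rpow h1γ.ne']
  | succ T ih =>
    rw [Finset.sum_Icc_succ_top (by omega)]
    refine (add_le_add_left ih _).trans ?_
    rw [← le_sub_iff_add_le', ← sub_div, le_div_iff₀ h1γ]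
    have hT : (0 : ℝ) < (T + 1 : ℕ) := by positivity
    set τ : ℝ := ((T + 1 : ℕ) : ℝ) with hτ
    have hTτ : (T : ℝ) = τ * (1 + -τ⁻¹) := by
      rw [mul_add, mul_neg, mul_inv_cancel₀ hT.ne', hτ]
      push_cast
      ring
    have hinv : τ⁻¹ ≤ 1 := by
      refine inv_le_one_of_one_le₀ ?_
      rw [hτ]
      exact_mod_cast Nat.succ_le_succ (Nat.zero_le T)
    have hB := rpow_one_add_le_one_add_mul_self (s := -τ⁻¹) (p := 1 - γ) (by linarith)
      h1γ.le (by linarith)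
    have hpow : (T : ℝ) ^ (1 - γ) ≤ τ ^ (1 - γ) * (1 + (1 - γ) * -τ⁻¹) := by
      rw [hTτ, Real.mul_rpow hT.le (by linarith)]
      exact mul_le_mul_of_nonneg_left hB (by positivity)
    have hid : τ ^ (1 - γ) * τ⁻¹ = (τ ^ γ)⁻¹ := by
      rw [Real.rpow_sub hT, Real.rpow_one]
      field_simp
    have : τ ^ (1 - γ) * (1 + (1 - γ) * -τ⁻¹) = τ ^ (1 - γ) - (1 - γ) * (τ ^ γ)⁻¹ := by
      rw [← hid]
      ring
    linarith

/-! ### The inner loop as a tracking run with projected gradients. -/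

section Algorithm

variable {n d : ℕ} {p : Problem n d} {a : Input n d} {ζ M L G : ℝ} {T t : ℕ}

/-- The gradients of the losses of round `t`, projected on the directions of the feasible set. -/
noncomputable def Problem.projGradient (p : Problem n d) (t : ℕ) (i : Fin n)
    (z : EuclideanSpace ℝ (Fin d)) : EuclideanSpace ℝ (Fin d) :=
  (vectorSpan ℝ p.X).starProjection (gradient (p.f i t) z)

namespace Problem.Assumptions

lemma sum_inNbrs (h : p.Assumptions ζ M L G T) (ht : t ∈ Finset.Icc 1 T)
    (x : Fin n → EuclideanSpace ℝ (Fin d)) (i : Fin n) :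
    ∑ j ∈ p.inNbrs t i, p.A t i j • x j = mix (p.A t) x i := by
  refine Finset.sum_subset (Finset.subset_univ _) fun j _ hj => ?_
  rw [h.weight_zero t ht i j hj, zero_smul]

lemma disp_mix_le [NeZero n] (h : p.Assumptions ζ M L G T) (hζ : 0 < ζ)
    (ht : t ∈ Finset.Icc 1 T) (x : Fin n → EuclideanSpace ℝ (Fin d)) :
    disp (mix (p.A t) x) ≤ contraction n ζ * disp x := by
  have hedge : ∀ i, ∀ j ∈ p.inNbrs t i, ζ < p.A t i j := fun i j hj =>
    h.weight_gt t ht i j (h.weight_pos t ht i j hj)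
  have := DOMFW.disp_mix_le (h.doubly_stochastic t ht) hζ (h.strongly_connected t ht)
    (fun i => hedge i i (by simp [inNbrs])) (fun i j hij => hedge j i (by simp [inNbrs, hij])) x
  simpa using this

lemma smoothConvexOn (h : p.Assumptions ζ M L G T) (ht : t ∈ Finset.Icc 1 T) (i : Fin n) :
    SmoothConvexOn p.X (p.f i t) (p.projGradient t i) L G := by
  have hproj : ∀ x ∈ p.X, ∀ z ∈ p.X, inner ℝ (p.projGradient t i z) (x - z)
      = inner ℝ (gradient (p.f i t) z) (x - z) := fun x hx z hz =>
    inner_starProjection_sub _ (vsub_mem_vectorSpan ℝ hx hz)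
  refine ⟨fun x hx z hz => ?_, fun x hx z hz => ?_, h.lipschitz i t ht⟩
  · rw [hproj x hx z hz]
    exact add_inner_gradient_le (h.convex_f i t ht) hx hz (h.differentiable i t ht z hz)
  · rw [hproj x hx z hz]
    exact h.smooth i t ht x hx z hz

lemma norm_projGradient_sub_le (h : p.Assumptions ζ M L G T) (hG : 0 ≤ G)
    (ht : t ∈ Finset.Icc 1 T) (i : Fin n) {y z : EuclideanSpace ℝ (Fin d)} (hy : y ∈ p.X)
    (hz : z ∈ p.X) : ‖p.projGradient t i z - p.projGradient t i y‖ ≤ G * ‖z - y‖ := by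
  obtain ⟨w, r, hr, hw⟩ := exists_relBall h.convex_X ⟨y, hy⟩
  exact (h.smoothConvexOn ht i).norm_sub_le h.convex_X
    (fun z => Submodule.starProjection_apply_mem _ _) hG hr hw hy hz

lemma norm_projGradient_le (h : p.Assumptions ζ M L G T) (hL : 0 ≤ L) (hG : 0 ≤ G)
    (ht : t ∈ Finset.Icc 1 T) (i : Fin n) {z : EuclideanSpace ℝ (Fin d)}
    (hz : z ∈ p.X) : ‖p.projGradient t i z‖ ≤ L + G * M := by
  obtain ⟨w, r, hr, hw⟩ := exists_relBall h.convex_X ⟨z, hz⟩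
  exact (h.smoothConvexOn ht i).norm_le h.convex_X
    (fun z => Submodule.starProjection_apply_mem _ _) hL hG hr hw h.diam_le hz

/-- The inner iterations of a round, with gradient estimates projected on the directions of the
feasible set. -/
lemma trackingRun (h : p.Assumptions ζ M L G T) (ht : t ∈ Finset.Icc 1 T) (ha : a.Valid p.X)
    {s : State n d} (hs : ∀ i, s.x i ∈ p.X) :
    TrackingRun (p.A t) p.X (p.projGradient t) (a.α t) (fun k => (innerLoop p a t s k).x)
      (fun k i => (vectorSpan ℝ p.X).starProjection ((innerLoop p a t s (k + 1)).ghat i))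
      (fun k i => a.oracle i t (k + 1) ((innerLoop p a t s (k + 1)).ghat i)) := by
  set P := (vectorSpan ℝ p.X).starProjection
  have hP : ∀ x : Fin n → EuclideanSpace ℝ (Fin d),
      (fun i => P (mix (p.A t) x i)) = mix (p.A t) fun i => P (x i) := fun x => by
    funext i
    simp [mix, map_sum]
  have hxhat : ∀ k, (innerLoop p a t s (k + 1)).xhat = mix (p.A t) (innerLoop p a t s k).x :=
    fun k => funext fun i => h.sum_inNbrs ht _ i
  -- Inner iterations are numbered from one, so index `k` of the run is iteration `k + 1`: its
  -- points are read before that iteration, its estimates and oracle answers after it.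
  refine ⟨hs, fun k i => (ha.oracle_mem _ _ _ _).1, fun k i z hz => ?_, fun k => ?_, ?_,
    fun k => ?_⟩
  · obtain ⟨hv, hmin⟩ := ha.oracle_mem i t (k + 1) ((innerLoop p a t s (k + 1)).ghat i)
    have h1 := hmin z hz
    have h2 := inner_starProjection_sub ((innerLoop p a t s (k + 1)).ghat i)
      (vsub_mem_vectorSpan ℝ hz hv)
    rw [vsub_eq_sub, inner_sub_right, inner_sub_right] at h2
    simp only [real_inner_comm] at h1 h2 ⊢
    linarith
  · rw [← hxhat k]
    rfl
  · have : (innerLoop p a t s (0 + 1)).ghat = mix (p.A t) fun i =>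
        gradient (p.f i t) (mix (p.A t) (innerLoop p a t s 0).x i) := by
      funext i
      refine (h.sum_inNbrs ht _ i).trans ?_
      congr 1
      funext j
      rw [if_pos rfl]
      exact congrArg _ (h.sum_inNbrs ht _ j)
    rw [this, hP]
    rfl
  · have : (innerLoop p a t s (k + 1 + 1)).ghat = mix (p.A t) fun i =>
        (innerLoop p a t s (k + 1)).ghat i
          + gradient (p.f i t) (mix (p.A t) (innerLoop p a t s (k + 1)).x i)
          - gradient (p.f i t) (mix (p.A t) (innerLoop p a t s k).x i) := by
      funext i
      refine (h.sum_inNbrs ht _ i).trans ?_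
      congr 1
      funext j
      rw [if_neg (by omega), ← hxhat k, ← hxhat (k + 1)]
      rfl
    rw [this, hP]
    congr 1
    funext i
    simp [Problem.projGradient, P]

end Problem.Assumptions

end Algorithm

/-! ### From single rounds to the regret and the number of oracle calls. -/

section Algorithm

variable {n d : ℕ} {p : Problem n d} {a : Input n d} {ζ M L G : ℝ} {T t : ℕ}

/-- The dispersion added by the Frank-Wolfe steps of a round, relative to the step size. -/
noncomputable def dispersionConst (n : ℕ) (ζ M : ℝ) : ℝ := n * M / (1 - contraction n ζ)

/-- The optimality gap added by the Frank-Wolfe steps of a round, relative to the step size. -/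
noncomputable def gapConst (n : ℕ) (ζ M L G : ℝ) : ℝ :=
  2 * recursionConst (contraction n ζ) (roundConst n L G M)

lemma gapConst_nonneg [NeZero n] (hζ : 0 < ζ) (hM : 0 ≤ M) (hL : 0 ≤ L) (hG : 0 ≤ G) :
    0 ≤ gapConst n ζ M L G := by
  have : 0 ≤ roundConst n L G M := by
    unfold roundConst
    positivity
  exact mul_nonneg zero_le_two
    (recursionConst_nonneg (contraction_lt_one (Nat.pos_of_neZero n) hζ) this)

namespace Problem.Assumptions

lemma innerLoop_mem [NeZero n] (h : p.Assumptions ζ M L G T) (ht : t ∈ Finset.Icc 1 T)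
    (ha : a.Valid p.X) (hα : 0 ≤ a.α t) (hα1 : a.α t ≤ 1) {s : State n d}
    (hs : ∀ i, s.x i ∈ p.X) (k : ℕ) (i : Fin n) : (innerLoop p a t s k).x i ∈ p.X :=
  (h.trackingRun ht ha hs).x_mem (h.doubly_stochastic t ht) h.convex_X hα hα1 k i

/-- The additive errors form a geometric series bounded by `n * M / (1 - σ)`. Keeping a single
factor `σ` on the initial dispersion suffices for summing over rounds, hence at least one inner
iteration. -/
lemma disp_innerLoop_le [NeZero n] (h : p.Assumptions ζ M L G T) (hζ : 0 < ζ) (hM : 0 ≤ M)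
    (ht : t ∈ Finset.Icc 1 T) (ha : a.Valid p.X) (hα : 0 ≤ a.α t) (hα1 : a.α t ≤ 1)
    {s : State n d} (hs : ∀ i, s.x i ∈ p.X) (k : ℕ) :
    disp (innerLoop p a t s (k + 1)).x
      ≤ contraction n ζ * disp s.x + dispersionConst n ζ M * a.α t := by
  set σ := contraction n ζ with hσ
  have hσ0 : 0 ≤ σ := contraction_nonneg n ζ
  have hσ1 : 0 < 1 - σ := sub_pos.2 (contraction_lt_one (Nat.pos_of_neZero n) hζ)
  have hstep := (h.trackingRun ht ha hs).disp_x_succ_le h.convex_X hM h.diam_le hα hα1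
    (h.disp_mix_le hζ ht)
  simp only [Fintype.card_fin] at hstep
  set c := dispersionConst n ζ M with hc
  have hcσ : c * (1 - σ) = n * M := div_mul_cancel₀ _ hσ1.ne'
  have hc0 : 0 ≤ c * a.α t := mul_nonneg (div_nonneg (by positivity) hσ1.le) hα
  have hid : n * M * a.α t = c * a.α t - σ * (c * a.α t) := by
    rw [← hcσ]
    ring
  induction k with
  | zero =>
    have h0 := hstep 0
    have h1 := mul_nonneg hσ0 hc0
    simp only [innerLoop] at h0 ⊢
    linarith
  | succ k ih =>
    have h0 := hstep (k + 1)
    have h1 := mul_le_mul_of_nonneg_left ih hσ0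
    have h2 : σ * (σ * disp s.x) ≤ σ * disp s.x :=
      mul_le_of_le_one_left (mul_nonneg hσ0 (disp_nonneg _)) (by linarith)
    linarith

lemma gap_innerLoop_le [NeZero n] (h : p.Assumptions ζ M L G T) (hζ : 0 < ζ) (hM : 0 ≤ M)
    (hL : 0 ≤ L) (hG : 0 ≤ G) (ht : t ∈ Finset.Icc 1 T) (ha : a.Valid p.X) (hα : 0 ≤ a.α t)
    (hα1 : a.α t ≤ 1) {s : State n d} (hs : ∀ i, s.x i ∈ p.X) {k : ℕ} (hk : a.α t * k ≤ 1)
    {z : EuclideanSpace ℝ (Fin d)} (hz : z ∈ argminOn p.X (p.F t)) :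
    p.F t (avg (innerLoop p a t s k).x) - p.F t z
      ≤ Real.exp (-(a.α t * k)) * (p.F t (avg s.x) - p.F t z) + gapConst n ζ M L G * a.α t := by
  have key := (h.trackingRun ht ha hs).gap_le (h.doubly_stochastic t ht) h.convex_X hM h.diam_le
    hα hα1 (contraction_nonneg n ζ) (contraction_lt_one (Nat.pos_of_neZero n) hζ)
    (h.disp_mix_le hζ ht) hL hG (h.smoothConvexOn ht)
    (fun i y hy z hz => h.norm_projGradient_sub_le hG ht i hy hz)
    (fun i z hz => h.norm_projGradient_le hL hG ht i hz) hz.1 k hk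
  rw [Fintype.card_fin] at key
  refine le_trans key (add_le_add_left ?_ _)
  refine mul_le_mul_of_nonneg_right ?_ (sub_nonneg.2 (hz.2 _ (avg_mem h.convex_X hs)))
  calc (1 - a.α t) ^ k ≤ Real.exp (-a.α t) ^ k :=
        pow_le_pow_left₀ (by linarith) (Real.one_sub_le_exp_neg _) k
    _ = Real.exp (-(a.α t * k)) := by
        rw [← Real.exp_nat_mul]
        congr 1
        ring

lemma run_mem [NeZero n] (h : p.Assumptions ζ M L G T) (ha : a.Valid p.X)
    (hα : ∀ t ∈ Finset.Icc 1 T, 0 ≤ a.α t ∧ a.α t ≤ 1) (htT : t ≤ T) (i : Fin n) :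
    (run p a t).x i ∈ p.X := by
  induction t generalizing i with
  | zero => exact ha.init_mem i
  | succ t ih =>
    have ht : t + 1 ∈ Finset.Icc 1 T := Finset.mem_Icc.2 ⟨by omega, htT⟩
    exact h.innerLoop_mem ht ha (hα _ ht).1 (hα _ ht).2 (ih (by omega)) _ i

/-- A real supremum over an unbounded range is `0` by convention, so boundedness must be shown; it
follows from the Lipschitz bounds and the diameter. -/
lemma abs_sub_le_iSup (h : p.Assumptions ζ M L G T) (hL : 0 ≤ L)
    (ht : t ∈ Finset.Icc 1 (T - 1)) (i : Fin n) {x : EuclideanSpace ℝ (Fin d)} (hx : x ∈ p.X) :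
    |p.f i (t + 1) x - p.f i t x| ≤ ⨆ i : Fin n, ⨆ x : p.X, |p.f i (t + 1) x - p.f i t x| := by
  have ht' := Finset.mem_Icc.1 ht
  have h0 : t ∈ Finset.Icc 1 T := Finset.mem_Icc.2 ⟨by omega, by omega⟩
  have h1 : t + 1 ∈ Finset.Icc 1 T := Finset.mem_Icc.2 ⟨by omega, by omega⟩
  have hbdd : BddAbove (Set.range fun z : p.X => |p.f i (t + 1) z - p.f i t z|) := by
    refine ⟨|p.f i (t + 1) x - p.f i t x| + 2 * (L * M), ?_⟩
    rintro _ ⟨z, rfl⟩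
    have e1 := (h.lipschitz i t h0 z z.2 x hx).trans
      (mul_le_mul_of_nonneg_left (h.diam_le z z.2 x hx) hL)
    have e2 := (h.lipschitz i (t + 1) h1 z z.2 x hx).trans
      (mul_le_mul_of_nonneg_left (h.diam_le z z.2 x hx) hL)
    have e3 : p.f i (t + 1) z - p.f i t z = (p.f i (t + 1) x - p.f i t x)
        + ((p.f i (t + 1) z - p.f i (t + 1) x) - (p.f i t z - p.f i t x)) := by ring
    simp only [e3]
    refine (abs_add_le _ _).trans (add_le_add_right ((abs_sub _ _).trans ?_) _)
    linarith
  exact (le_ciSup hbdd ⟨x, hx⟩).trans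
    (le_ciSup (f := fun i : Fin n => ⨆ x : p.X, |p.f i (t + 1) x - p.f i t x|)
      (Set.finite_range _).bddAbove i)

/-- The change of the optimality gap when the loss of round `t` is replaced by the next one. -/
lemma gap_succ_le (h : p.Assumptions ζ M L G T) (hL : 0 ≤ L)
    (ht : t ∈ Finset.Icc 1 (T - 1)) {u z z' : EuclideanSpace ℝ (Fin d)} (hu : u ∈ p.X)
    (hz : z ∈ argminOn p.X (p.F t)) (hz' : z' ∈ p.X) :
    p.F (t + 1) u - p.F (t + 1) z' ≤ p.F t u - p.F t z
      + 2 * n * ⨆ i : Fin n, ⨆ x : p.X, |p.f i (t + 1) x - p.f i t x| := by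
  set δ := ⨆ i : Fin n, ⨆ x : p.X, |p.f i (t + 1) x - p.f i t x|
  have hdiff : ∀ x ∈ p.X, |p.F (t + 1) x - p.F t x| ≤ n * δ := by
    intro x hx
    rw [Problem.F, Problem.F, ← Finset.sum_sub_distrib]
    refine (Finset.abs_sum_le_sum_abs _ _).trans ?_
    refine (Finset.sum_le_sum fun i _ => h.abs_sub_le_iSup hL ht i hx).trans (le_of_eq ?_)
    simp [δ]
  have h1 := (abs_le.1 (hdiff u hu)).2
  have h2 := (abs_le.1 (hdiff z' hz')).1
  have h3 := hz.2 z' hz'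
  linarith

lemma F_sub_le (h : p.Assumptions ζ M L G T) (ht : t ∈ Finset.Icc 1 T)
    {x z : EuclideanSpace ℝ (Fin d)} (hx : x ∈ p.X) (hz : z ∈ p.X) :
    p.F t x - p.F t z ≤ n * L * ‖x - z‖ := by
  rw [Problem.F, Problem.F, ← Finset.sum_sub_distrib]
  refine (Finset.sum_le_sum fun i _ =>
    (le_abs_self _).trans (h.lipschitz i t ht x hx z hz)).trans (le_of_eq ?_)
  simp
  ring

/-- Regret bound for step sizes with `α t * K t = 1 / ρ`. -/
lemma regret_le [NeZero n] (h : p.Assumptions ζ M L G T) (hζ : 0 < ζ) (hM : 0 ≤ M)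
    (hL : 0 ≤ L) (hG : 0 ≤ G) (hT : 1 ≤ T) (ha : a.Valid p.X) {ρ : ℝ} (hρ : 1 ≤ ρ)
    (hK : ∀ t ∈ Finset.Icc 1 T, 1 ≤ a.K t)
    (hα : ∀ t ∈ Finset.Icc 1 T, a.α t = 1 / (ρ * (a.K t : ℝ)))
    {xstar : ℕ → EuclideanSpace ℝ (Fin d)}
    (hx : ∀ t ∈ Finset.Icc 1 T, xstar t ∈ argminOn p.X (p.F t)) (j : Fin n) :
    regret p a xstar j T
      ≤ (n * L * M + (gapConst n ζ M L G * ∑ t ∈ Finset.Icc 1 (T - 1), a.α t + 2 * n * p.H T))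
          / (1 - Real.exp (-(1 / ρ)))
        + n * L * ((n * M + dispersionConst n ζ M * ∑ t ∈ Finset.Icc 1 (T - 1), a.α t)
          / (1 - contraction n ζ)) := by
  have hρ0 : 0 < ρ := by linarith
  -- The total step of a round does not depend on `t`: this yields the common contraction factor
  -- `exp (-(1 / ρ))`, and `1 / ρ ≤ 1` is what `gap_innerLoop_le` needs.
  have hαK : ∀ t ∈ Finset.Icc 1 T, a.α t * a.K t = 1 / ρ := by
    intro t ht
    have : (a.K t : ℝ) ≠ 0 := by
      have := hK t ht
      positivity
    rw [hα t ht]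
    field_simp
  have hρ1 : 1 / ρ ≤ 1 := by
    rw [div_le_one hρ0]
    exact hρ
  have hα01 : ∀ t ∈ Finset.Icc 1 T, 0 ≤ a.α t ∧ a.α t ≤ 1 := by
    intro t ht
    have h0 : 0 ≤ a.α t := by
      rw [hα t ht]
      positivity
    refine ⟨h0, le_trans (le_mul_of_one_le_right h0 ?_) ((hαK t ht).trans_le hρ1)⟩
    exact_mod_cast hK t ht
  have hsub : ∀ t ∈ Finset.Icc 1 (T - 1), t ∈ Finset.Icc 1 T ∧ t + 1 ∈ Finset.Icc 1 T := by
    intro t ht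
    simp only [Finset.mem_Icc] at ht ⊢
    omega
  set x : ℕ → Fin n → EuclideanSpace ℝ (Fin d) := fun t => (run p a (t - 1)).x with hxdef
  have hxX : ∀ t ∈ Finset.Icc 1 T, ∀ i, x t i ∈ p.X := fun t ht i =>
    h.run_mem ha hα01 ((Nat.sub_le _ _).trans (Finset.mem_Icc.1 ht).2) i
  have hrun : ∀ t, 1 ≤ t → x (t + 1) = (innerLoop p a t (run p a (t - 1)) (a.K t)).x := by
    intro t ht
    obtain ⟨m, rfl⟩ : ∃ m, t = m + 1 := ⟨t - 1, by omega⟩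
    rfl
  have h1T : 1 ∈ Finset.Icc 1 T := Finset.mem_Icc.2 ⟨le_rfl, hT⟩
  have hdisp : ∑ t ∈ Finset.Icc 1 T, disp (x t)
      ≤ (n * M + dispersionConst n ζ M * ∑ t ∈ Finset.Icc 1 (T - 1), a.α t)
          / (1 - contraction n ζ) := by
    have hσ1 := contraction_lt_one (Nat.pos_of_neZero n) hζ
    refine (sum_le_of_contraction (e := fun t => dispersionConst n ζ M * a.α t)
      (contraction_nonneg n ζ) hσ1 hT (disp_nonneg _) fun t ht => ?_).trans ?_
    · obtain ⟨ht1, -⟩ := hsub t ht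
      obtain ⟨k, hk⟩ : ∃ k, a.K t = k + 1 := ⟨a.K t - 1, by have := hK t ht1; omega⟩
      rw [hrun t (Finset.mem_Icc.1 ht1).1, hk]
      exact h.disp_innerLoop_le hζ hM ht1 ha (hα01 t ht1).1 (hα01 t ht1).2 (hxX t ht1) k
    · rw [← Finset.mul_sum]
      refine div_le_div_of_nonneg_right (add_le_add_left ?_ _) (by linarith)
      simpa using disp_le_of_diam h.convex_X hM h.diam_le (hxX 1 h1T)
  have hgap : ∑ t ∈ Finset.Icc 1 T, (p.F t (avg (x t)) - p.F t (xstar t))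
      ≤ (n * L * M + (gapConst n ζ M L G * ∑ t ∈ Finset.Icc 1 (T - 1), a.α t + 2 * n * p.H T))
          / (1 - Real.exp (-(1 / ρ))) := by
    have hr1 : Real.exp (-(1 / ρ)) < 1 := by
      rw [Real.exp_lt_one_iff]
      have : 0 < 1 / ρ := by positivity
      linarith
    have hTT : T ∈ Finset.Icc 1 T := Finset.mem_Icc.2 ⟨hT, le_rfl⟩
    refine (sum_le_of_contraction (e := fun t => gapConst n ζ M L G * a.α t
        + 2 * n * ⨆ i : Fin n, ⨆ x : p.X, |p.f i (t + 1) x - p.f i t x|)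
      (Real.exp_pos _).le hr1 hT ?_ fun t ht => ?_).trans ?_
    · exact sub_nonneg.2 ((hx T hTT).2 _ (avg_mem h.convex_X (hxX T hTT)))
    · obtain ⟨ht1, ht2⟩ := hsub t ht
      have h1 := h.gap_succ_le hL ht (avg_mem h.convex_X (hxX _ ht2)) (hx t ht1) (hx _ ht2).1
      have h2 := h.gap_innerLoop_le hζ hM hL hG ht1 ha (hα01 t ht1).1 (hα01 t ht1).2 (hxX t ht1)
        ((hαK t ht1).trans_le hρ1) (hx t ht1)
      rw [hαK t ht1, ← hrun t (Finset.mem_Icc.1 ht1).1] at h2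
      linarith
    · rw [Finset.sum_add_distrib, ← Finset.mul_sum, ← Finset.mul_sum]
      refine div_le_div_of_nonneg_right (add_le_add_left ?_ _) (by linarith)
      have hz := (hx 1 h1T).1
      have hu := avg_mem h.convex_X (hxX 1 h1T)
      exact (h.F_sub_le h1T hu hz).trans
        (mul_le_mul_of_nonneg_left (h.diam_le _ hu _ hz) (by positivity))
  -- Agent `j` differs from the mean by at most the dispersion, at Lipschitz cost `n * L`.
  have hterm : ∀ t ∈ Finset.Icc 1 T, p.F t (decision p a j t) - p.F t (xstar t)
      ≤ (p.F t (avg (x t)) - p.F t (xstar t)) + n * L * disp (x t) := by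
    intro t ht
    have h1 := h.F_sub_le ht (hxX t ht j) (avg_mem h.convex_X (hxX t ht))
    have h2 := mul_le_mul_of_nonneg_left (norm_sub_avg_le_disp (x t) j)
      (by positivity : 0 ≤ n * L)
    have h3 : decision p a j t = x t j := rfl
    rw [h3]
    linarith
  calc regret p a xstar j T
      = ∑ t ∈ Finset.Icc 1 T, (p.F t (decision p a j t) - p.F t (xstar t)) := by
        rw [regret, Finset.sum_sub_distrib]
    _ ≤ ∑ t ∈ Finset.Icc 1 T,
          ((p.F t (avg (x t)) - p.F t (xstar t)) + n * L * disp (x t)) := Finset.sum_le_sum hterm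
    _ = ∑ t ∈ Finset.Icc 1 T, (p.F t (avg (x t)) - p.F t (xstar t))
          + n * L * ∑ t ∈ Finset.Icc 1 T, disp (x t) := by
        rw [Finset.sum_add_distrib, Finset.mul_sum]
    _ ≤ _ := add_le_add hgap (mul_le_mul_of_nonneg_left hdisp (by positivity))

end Problem.Assumptions

lemma innerLoop_calls (s : State n d) (k : ℕ) (i : Fin n) :
    (innerLoop p a t s k).calls i = s.calls i + k := by
  induction k with
  | zero => rfl
  | succ k ih => exact (congrArg (· + 1) ih).trans (by ring)

lemma oracleCalls_eq_sum (p : Problem n d) (a : Input n d) (i : Fin n) (T : ℕ) :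
    oracleCalls p a i T = ∑ t ∈ Finset.Icc 1 T, a.K t := by
  induction T with
  | zero => rfl
  | succ T ih =>
    rw [Finset.sum_Icc_succ_top (by omega), ← ih]
    exact innerLoop_calls _ _ _

end Algorithm

/-! ### The choice of inner counts and step sizes, and uniform constants. -/

lemma Problem.H_nonneg {n d : ℕ} (p : Problem n d) (T : ℕ) : 0 ≤ p.H T :=
  Finset.sum_nonneg fun _ _ => Real.iSup_nonneg fun _ => Real.iSup_nonneg fun _ => abs_nonneg _

lemma innerCount_le {ε γ : ℝ} (hε : 0 < ε) (hγ : 0 ≤ γ) {t T : ℕ} (ht : t ∈ Finset.Icc 1 T) :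
    (innerCount ε γ t : ℝ) ≤ (ε + 2) * (T : ℝ) ^ γ := by
  obtain ⟨h1, h2⟩ := Finset.mem_Icc.1 ht
  have h1' : (1 : ℝ) ≤ t := by exact_mod_cast h1
  have h2' : (t : ℝ) ≤ T := by exact_mod_cast h2
  have e1 : (t : ℝ) ^ γ ≤ (T : ℝ) ^ γ := Real.rpow_le_rpow (by linarith) h2' hγ
  have e2 : 1 ≤ (T : ℝ) ^ γ := Real.one_le_rpow (by linarith) hγ
  have e3 := Nat.ceil_lt_add_one (a := ε * (t : ℝ) ^ γ) (by positivity)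
  have e4 := mul_le_mul_of_nonneg_left e1 hε.le
  unfold innerCount
  push_cast
  linarith

/-- Here `α t ≤ 1 / (ε t ^ γ)`; enlarging `1 / (1 - γ)` to `1 / (1 - γmax)` keeps the constant
independent of `γ`. -/
lemma sum_stepSize_le {n d : ℕ} {a : Input n d} {ρ ε γ γmax : ℝ} {T : ℕ} (hρ : 1 ≤ ρ)
    (hε : 0 < ε) (hγ : 0 ≤ γ) (hγγ : γ ≤ γmax) (hγmax : γmax < 1)
    (hK : ∀ t ∈ Finset.Icc 1 T, a.K t = innerCount ε γ t)
    (hα : ∀ t ∈ Finset.Icc 1 T, a.α t = 1 / (ρ * (a.K t : ℝ))) :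
    ∑ t ∈ Finset.Icc 1 (T - 1), a.α t ≤ 1 / (ε * (1 - γmax)) * (T : ℝ) ^ (1 - γ) := by
  have hterm : ∀ t ∈ Finset.Icc 1 T, 0 ≤ a.α t ∧ a.α t ≤ ε⁻¹ * ((t : ℝ) ^ γ)⁻¹ := by
    intro t ht
    have ht0 : (0 : ℝ) < t := by exact_mod_cast (Finset.mem_Icc.1 ht).1
    rw [hα t ht, hK t ht]
    refine ⟨by positivity, ?_⟩
    rw [← mul_inv, one_div]
    refine inv_anti₀ (by positivity) ?_
    have h1 := Nat.le_ceil (ε * (t : ℝ) ^ γ)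
    have h2 : ε * (t : ℝ) ^ γ ≤ (innerCount ε γ t : ℝ) := by
      unfold innerCount
      push_cast
      linarith
    exact h2.trans (le_mul_of_one_le_left (by positivity) hρ)
  have h1γ : 0 < 1 - γmax := by linarith
  calc ∑ t ∈ Finset.Icc 1 (T - 1), a.α t ≤ ∑ t ∈ Finset.Icc 1 T, a.α t :=
        Finset.sum_le_sum_of_subset_of_nonneg
          (Finset.Icc_subset_Icc_right (Nat.sub_le T 1)) fun t ht _ => (hterm t ht).1
    _ ≤ ∑ t ∈ Finset.Icc 1 T, ε⁻¹ * ((t : ℝ) ^ γ)⁻¹ :=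
        Finset.sum_le_sum fun t ht => (hterm t ht).2
    _ ≤ ε⁻¹ * ((T : ℝ) ^ (1 - γ) / (1 - γmax)) := by
        rw [← Finset.mul_sum]
        refine mul_le_mul_of_nonneg_left
          ((sum_rpow_neg_le hγ (by linarith) T).trans ?_) (by positivity)
        exact div_le_div_of_nonneg_left (by positivity) h1γ (by linarith)
    _ = _ := by
        field_simp

/-- The constant of the regret bound. -/
noncomputable def regretConst (n : ℕ) (ζ M L G ρ ε γmax : ℝ) : ℝ :=
  (n * L * M + (gapConst n ζ M L G * (1 / (ε * (1 - γmax))) + 2 * n))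
      / (1 - Real.exp (-(1 / ρ)))
    + n * L * ((n * M + dispersionConst n ζ M * (1 / (ε * (1 - γmax)))) / (1 - contraction n ζ))

section Constants

variable {n d : ℕ} [NeZero n] {ζ M L G ρ ε γ γmax : ℝ}

lemma dispersionConst_nonneg (hζ : 0 < ζ) (hM : 0 ≤ M) : 0 ≤ dispersionConst n ζ M :=
  div_nonneg (by positivity) (sub_nonneg.2 (contraction_lt_one (Nat.pos_of_neZero n) hζ).le)

lemma one_sub_exp_pos (hρ : 1 ≤ ρ) : 0 < 1 - Real.exp (-(1 / ρ)) := by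
  rw [sub_pos, Real.exp_lt_one_iff, neg_lt_zero]
  positivity

lemma regretConst_nonneg (hζ : 0 < ζ) (hM : 0 ≤ M) (hL : 0 ≤ L) (hG : 0 ≤ G) (hρ : 1 ≤ ρ)
    (hε : 0 < ε) (hγmax : γmax < 1) : 0 ≤ regretConst n ζ M L G ρ ε γmax := by
  have h1 := gapConst_nonneg (n := n) hζ hM hL hG
  have h2 := dispersionConst_nonneg (n := n) hζ hM
  have h3 : 0 < 1 - contraction n ζ :=
    sub_pos.2 (contraction_lt_one (Nat.pos_of_neZero n) hζ)
  have h4 := one_sub_exp_pos hρ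
  have h5 : 0 < 1 - γmax := by linarith
  unfold regretConst
  positivity

lemma Problem.Assumptions.regret_le_regretConst_mul {p : Problem n d} {a : Input n d} {T : ℕ}
    (h : p.Assumptions ζ M L G T) (hζ : 0 < ζ) (hM : 0 ≤ M) (hL : 0 ≤ L) (hG : 0 ≤ G)
    (hT : 1 ≤ T) (ha : a.Valid p.X) (hρ : 1 ≤ ρ) (hε : 0 < ε) (hγ : 0 ≤ γ) (hγγ : γ ≤ γmax)
    (hγmax : γmax < 1)
    (hK : ∀ t ∈ Finset.Icc 1 T, a.K t = innerCount ε γ t)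
    (hα : ∀ t ∈ Finset.Icc 1 T, a.α t = 1 / (ρ * (a.K t : ℝ)))
    {xstar : ℕ → EuclideanSpace ℝ (Fin d)}
    (hx : ∀ t ∈ Finset.Icc 1 T, xstar t ∈ argminOn p.X (p.F t)) (j : Fin n) :
    regret p a xstar j T
      ≤ regretConst n ζ M L G ρ ε γmax * ((T : ℝ) ^ (1 - γ) + p.H T) := by
  have hW : 1 ≤ (T : ℝ) ^ (1 - γ) :=
    Real.one_le_rpow (by exact_mod_cast hT) (by linarith)
  have hH := p.H_nonneg T
  have hS := sum_stepSize_le hρ hε hγ hγγ hγmax hK hα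
  have hreg := h.regret_le hζ hM hL hG hT ha hρ
    (fun t ht => by rw [hK t ht]; exact Nat.le_add_left 1 _) hα hx j
  set S := ∑ t ∈ Finset.Icc 1 (T - 1), a.α t
  set W := (T : ℝ) ^ (1 - γ)
  set Q := 1 / (ε * (1 - γmax)) with hQ
  have h1γ : 0 < 1 - γmax := by linarith
  have hQ0 : 0 ≤ Q := by positivity
  have hg := gapConst_nonneg (n := n) hζ hM hL hG
  have hd := dispersionConst_nonneg (n := n) hζ hM
  have hσ : 0 < 1 - contraction n ζ := sub_pos.2 (contraction_lt_one (Nat.pos_of_neZero n) hζ)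
  have hS' : S ≤ Q * (W + p.H T) :=
    hS.trans (mul_le_mul_of_nonneg_left (by linarith) hQ0)
  -- Since `T ^ (1 - γ) ≥ 1`, constant terms are absorbed into multiples of `W + p.H T`.
  have hWH : 1 ≤ W + p.H T := by linarith
  have e1 : (n : ℝ) * L * M ≤ n * L * M * (W + p.H T) :=
    le_mul_of_one_le_right (by positivity) hWH
  have e2 : (n : ℝ) * M ≤ n * M * (W + p.H T) := le_mul_of_one_le_right (by positivity) hWH
  have e3 : 2 * (n : ℝ) * p.H T ≤ 2 * n * (W + p.H T) :=
    mul_le_mul_of_nonneg_left (by linarith) (by positivity)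
  have e4 := mul_le_mul_of_nonneg_left hS' hg
  have e5 := mul_le_mul_of_nonneg_left hS' hd
  refine hreg.trans ?_
  rw [regretConst, add_mul, mul_assoc (n * L : ℝ), div_mul_eq_mul_div, div_mul_eq_mul_div]
  refine add_le_add (div_le_div_of_nonneg_right ?_ (one_sub_exp_pos hρ).le)
    (mul_le_mul_of_nonneg_left (div_le_div_of_nonneg_right ?_ hσ.le) (by positivity))
  · linarith
  · linarith

end Constants

lemma oracleCalls_le {n d : ℕ} (p : Problem n d) {a : Input n d} {ε γ : ℝ} {T : ℕ}
    (hT : 1 ≤ T) (hε : 0 < ε) (hγ : 0 ≤ γ)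
    (hK : ∀ t ∈ Finset.Icc 1 T, a.K t = innerCount ε γ t) (j : Fin n) :
    (oracleCalls p a j T : ℝ) ≤ (ε + 2) * (T : ℝ) ^ (1 + γ) := by
  have hT0 : (0 : ℝ) < T := by exact_mod_cast hT
  rw [oracleCalls_eq_sum, Nat.cast_sum, Real.rpow_add hT0, Real.rpow_one]
  calc ∑ t ∈ Finset.Icc 1 T, (a.K t : ℝ)
      ≤ ∑ _t ∈ Finset.Icc 1 T, (ε + 2) * (T : ℝ) ^ γ := Finset.sum_le_sum fun t ht => by
        rw [hK t ht]
        exact innerCount_le hε hγ ht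
    _ = (ε + 2) * (T * (T : ℝ) ^ γ) := by
        rw [Finset.sum_const, Nat.card_Icc, Nat.add_sub_cancel, nsmul_eq_mul]
        ring

lemma rpow_one_sub_le_of_one_sub_logb_le {T : ℕ} (hT : 2 ≤ T) {H γ : ℝ} (hH : 0 ≤ H)
    (hγ : γ < 1) (h : 1 - Real.logb T H ≤ γ) : (T : ℝ) ^ (1 - γ) ≤ H := by
  have hT1 : (1 : ℝ) < T := by exact_mod_cast hT
  have hH0 : 0 < H := by
    -- If `H = 0`, the convention `logb T 0 = 0` turns the hypothesis into `1 ≤ γ`, which is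
    -- excluded.
    refine hH.lt_of_ne fun h0 => ?_
    rw [← h0, Real.logb_zero] at h
    linarith
  calc (T : ℝ) ^ (1 - γ) ≤ (T : ℝ) ^ Real.logb T H :=
        Real.rpow_le_rpow_of_exponent_le hT1.le (by linarith)
    _ = H := Real.rpow_logb (by linarith) hT1.ne' hH0

end DOMFW

theorem corollary1 (n : ℕ) (ζ M L G ρ ε γmax : ℝ) (hζ : 0 < ζ) (hL : 0 < L) (hG : 0 < G)
    (hρ : 1 ≤ ρ) (hε : 0 < ε) (hγmax : γmax < 1) :
    ∃ C : ℝ, 0 < C ∧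
      ∀ (d : ℕ) (p : DOMFW.Problem n d) (T : ℕ), 2 ≤ T → p.Assumptions ζ M L G T →
      ∀ γ : ℝ, 0 < γ → γ ≤ γmax →
      ∀ a : DOMFW.Input n d, a.Valid p.X →
        (∀ t ∈ Finset.Icc 1 T, a.K t = DOMFW.innerCount ε γ t) →
        (∀ t ∈ Finset.Icc 1 T, a.α t = 1 / (ρ * (a.K t : ℝ))) →
      ∀ xstar : ℕ → EuclideanSpace ℝ (Fin d),
        (∀ t ∈ Finset.Icc 1 T, xstar t ∈ DOMFW.argminOn p.X (p.F t)) →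
      ∀ j : Fin n,
        (DOMFW.regret p a xstar j T ≤ C * ((T : ℝ) ^ (1 - γ) + p.H T) ∧
          (DOMFW.oracleCalls p a j T : ℝ) ≤ C * (T : ℝ) ^ (1 + γ)) ∧
        (1 - Real.logb T (p.H T) ≤ γ →
          DOMFW.regret p a xstar j T ≤ C * p.H T) ∧
        (γ = 1 - Real.logb T (p.H T) →
          DOMFW.regret p a xstar j T ≤ C * p.H T ∧
          (DOMFW.oracleCalls p a j T : ℝ) ≤ C * (T : ℝ) ^ (2 - Real.logb T (p.H T))) := by
  rcases Nat.eq_zero_or_pos n with rfl | hn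
  · exact ⟨1, one_pos, fun _ _ _ _ _ _ _ _ _ _ _ _ _ _ j => j.elim0⟩
  have : NeZero n := ⟨hn.ne'⟩
  -- A negative `M` contradicts the diameter bound at an initial point.
  rcases lt_or_ge M 0 with hM | hM
  · refine ⟨1, one_pos, fun d p T _ hp _ _ _ a ha _ _ _ _ j => ?_⟩
    have h0 := hp.diam_le _ (ha.init_mem j) _ (ha.init_mem j)
    exact absurd ((norm_nonneg _).trans h0) (not_le.2 hM)
  set C₀ := DOMFW.regretConst n ζ M L G ρ ε γmax
  have hC₀ : 0 ≤ C₀ := DOMFW.regretConst_nonneg hζ hM hL.le hG.le hρ hε hγmax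
  -- The factor `2` serves `T ^ (1 - γ) + H ≤ 2 * H`; the summand `ε + 2` is the constant of the
  -- call count and makes the sum positive.
  refine ⟨2 * C₀ + (ε + 2), by positivity, ?_⟩
  intro d p T hT hp γ hγ hγγ a ha hK hα xstar hx j
  have hH := p.H_nonneg T
  have hreg := hp.regret_le_regretConst_mul hζ hM hL.le hG.le (by omega) ha hρ hε hγ.le hγγ
    hγmax hK hα hx j
  have hcalls : (DOMFW.oracleCalls p a j T : ℝ) ≤ (2 * C₀ + (ε + 2)) * (T : ℝ) ^ (1 + γ) :=
    (DOMFW.oracleCalls_le p (by omega) hε hγ.le hK j).trans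
      (mul_le_mul_of_nonneg_right (by linarith) (by positivity))
  have hregH : 1 - Real.logb T (p.H T) ≤ γ →
      DOMFW.regret p a xstar j T ≤ (2 * C₀ + (ε + 2)) * p.H T := by
    intro hlog
    have hW := DOMFW.rpow_one_sub_le_of_one_sub_logb_le hT hH (by linarith) hlog
    have h1 := mul_le_mul_of_nonneg_left hW hC₀
    have h2 : 0 ≤ (ε + 2) * p.H T := by positivity
    linarith
  refine ⟨⟨hreg.trans ?_, hcalls⟩, hregH, fun hγeq => ⟨hregH hγeq.ge, ?_⟩⟩
  · exact mul_le_mul_of_nonneg_right (by linarith) (by positivity)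
  · rw [show 2 - Real.logb T (p.H T) = 1 + γ by rw [hγeq]; ring]
    exact hcalls
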